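/- **Theorem 2.1.** Let $d\ge 1$ and let $X_t=B_{S_t}$ be a subordinate Brownian motion on $\mathbb R^d$ corresponding to a Bernstein function $f\not\equiv 0$: $B$ is a Brownian motion with $\mathbb E\,e^{i\langle\xi,B_t-B_0\rangle}=e^{-t|\xi|^2}$ and $S$ is an independent subordinator (an increasing, right-continuous nonnegative Lévy process with $S_0=0$) with $\mathbb E\,e^{-\lambda S_t}=e^{-tf(\lambda)}$ for $\lambda>0$. Let $P^f_t(x,\cdot)$ be the transition function of $X$, and let $\|\cdot\|_{\mathrm{var}}$ be the total variation norm of signed measures. (i) $X$ has the coupling property: for any two initial laws $\mu_1,\mu_2$ there are, on one probability space, two càdlàg Markov processes $Y,Y'$ with transition function $P^f$ and initial laws $\mu_1,\mu_2$ such that $T=\inf\{t\ge 0:Y_t=Y'_t\}$ is almost surely finite (and $Y_t=Y'_t$ for all $t\ge T$). (ii) For $x,y\in\mathbb R^d$ let $B^x$ be such a Brownian motion starting from $x$, let $H_{x,y}=\{u:\langle u-\frac{x+y}{2},x-y\rangle=0\}$, let $R_{x,y}$ be the reflection in $H_{x,y}$ (the identity if $x=y$), and let $\tau_{x,y}=\inf\{t>0:B^x_t\in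 H_{x,y}\}$. Put $\hat B^y_t=R_{x,y}B^x_t$ for $t\le\tau_{x,y}$ and $\hat B^y_t=B^x_t$ for $t>\tau_{x,y}$. Let $S$ be a subordinator corresponding to $f$, independent of $B^x$, and let $T^X_{x,y}=\inf\{t\ge 0:B^x_{S_t}=\hat B^y_{S_t}\}$ be the coupling time of the reflection-subordinate coupling $(B^x_{S_t},\hat B^y_{S_t})$. Then for all $t>0$ and $x,y\in\mathbb R^d$, $$\|P^f_t(x,\cdot)-P^f_t(y,\cdot)\|_{\mathrm{var}}\le 2\,\mathbb P(T^X_{x,y}>t)\le\frac{|x-y|}{\pi}\int_0^\infty\frac{1}{\sqrt r}\,e^{-tf(r)}\,dr,$$ where the right-hand side may be infinite, and is read as $0$ if $x=y$. (iii) Assume in addition that $\liminf_{r\to\infty}f(r)/\log r>0$, that $\liminf_{r\to 0}f(r)|\log r|<\infty$, and that the inverse function $f^{-1}$ satisfies $\limsup_{s\to 0}f^{-1}(2s)/f^{-1}(s)<\infty$. Then there are constants $C>0$ and $t_0>0$ such that for all $t\ge t_0$ and all $x,y\in\mathbb R^d$, $$\|P^f_t(x,\cdot)-P^f_t(y,\cdot)\|_{\mathrm{var}}\le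 C\,|x-y|\,\sqrt{f^{-1}(1/t)}.$$ -/

import Mathlib

open MeasureTheory ProbabilityTheory Filter Topology Set
open scoped NNReal ENNReal

universe u v

noncomputable section

namespace SubordinateBM

/-- `d`-dimensional Euclidean space (with its Euclidean norm and Borel sets). -/
abbrev Eucl (d : ℕ) : Type := EuclideanSpace ℝ (Fin d)

/-- Bernstein functions on `(0, ∞)`: smooth, nonnegative, and `(-1) ^ (n + 1) f⁽ⁿ⁾ ≥ 0` for all
`n ≥ 1`. Only the values of `f` on `(0, ∞)` are relevant. -/
structure IsBernstein (f : ℝ → ℝ) : Prop where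
  contDiffOn : ContDiffOn ℝ ((⊤ : ℕ∞) : WithTop ℕ∞) f (Ioi 0)
  nonneg : ∀ r, 0 < r → 0 ≤ f r
  alternating : ∀ n : ℕ, 1 ≤ n → ∀ r, 0 < r → 0 ≤ (-1 : ℝ) ^ (n + 1) * iteratedDeriv n f r

/-- The inverse function of `f : (0, ∞) → ℝ`, defined on the range of `f`. -/
def inverse (f : ℝ → ℝ) : ℝ → ℝ := Function.invFunOn f (Ioi 0)

section Processes

variable {Ω : Type u} [MeasurableSpace Ω]

/-- Brownian motion on `ℝ^d` (with an arbitrary initial law), normalized by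
`𝔼 exp (i ξ (B_t - B_s)) = exp (-(t - s) |ξ|²)`, that is, running at twice the usual speed. -/
structure IsBrownianMotion {d : ℕ} (P : Measure Ω) (B : ℝ≥0 → Ω → Eucl d) : Prop where
  measurable : ∀ t, Measurable (B t)
  continuous_paths : ∀ᵐ ω ∂P, Continuous fun t => B t ω
  indep_increments : ∀ s h : ℝ≥0,
    IndepFun (fun ω => B (s + h) ω - B s ω) (fun ω (r : Iic s) => B r ω) P
  charFun_increments : ∀ (s h : ℝ≥0) (ξ : Eucl d),
    charFun (P.map fun ω => B (s + h) ω - B s ω) ξ =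
      Complex.exp (-((h : ℝ) * ‖ξ‖ ^ 2 : ℝ))

/-- Subordinators: nonnegative Lévy processes with increasing right-continuous paths that start
from `0`. -/
structure IsSubordinator (P : Measure Ω) (S : ℝ≥0 → Ω → ℝ≥0) : Prop where
  measurable : ∀ t, Measurable (S t)
  start : ∀ᵐ ω ∂P, S 0 ω = 0
  monotone_paths : ∀ᵐ ω ∂P, Monotone fun t => S t ω
  right_continuous_paths : ∀ᵐ ω ∂P, ∀ t, ContinuousWithinAt (fun t => S t ω) (Ici t) t
  indep_increments : ∀ s h : ℝ≥0,
    IndepFun (fun ω => (S (s + h) ω : ℝ) - S s ω) (fun ω (r : Iic s) => S r ω) P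
  stationary_increments : ∀ s h : ℝ≥0,
    IdentDistrib (fun ω => (S (s + h) ω : ℝ) - S s ω) (fun ω => (S h ω : ℝ)) P P

/-- The subordinator `S` corresponds to `f`: with `μ_t` the law of `S_t`,
`∫ exp (-λ s) μ_t(ds) = exp (-t f(λ))` for all `λ > 0`. -/
def HasLaplaceExponent (P : Measure Ω) (S : ℝ≥0 → Ω → ℝ≥0) (f : ℝ → ℝ) : Prop :=
  ∀ (t : ℝ≥0) (lam : ℝ), 0 < lam →
    ∫ s : ℝ≥0, Real.exp (-(lam * (s : ℝ))) ∂(P.map (S t)) = Real.exp (-((t : ℝ) * f lam))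

/-- The data of a subordinate Brownian motion `X_t = B_{S_t}` corresponding to `f`: a Brownian
motion `B` and an independent subordinator `S` corresponding to `f`. -/
structure IsSubordination {d : ℕ} (P : Measure Ω) (B : ℝ≥0 → Ω → Eucl d) (S : ℝ≥0 → Ω → ℝ≥0)
    (f : ℝ → ℝ) : Prop where
  brownian : IsBrownianMotion P B
  subordinator : IsSubordinator P S
  laplace : HasLaplaceExponent P S f
  indep : IndepFun (fun ω t => B t ω) (fun ω t => S t ω) P

/-- The process `B_{S_t}`. -/
def subordinate {Ω E : Type*} (B : ℝ≥0 → Ω → E) (S : ℝ≥0 → Ω → ℝ≥0) : ℝ≥0 → Ω → E :=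
  fun t ω => B (S t ω) ω

/-- The transition function of a Lévy process `X`: `P_t(x, A) = ℙ(x + (X_t - X_0) ∈ A)`. -/
def transitionFunction {d : ℕ} (P : Measure Ω) (X : ℝ≥0 → Ω → Eucl d) (t : ℝ≥0) (x : Eucl d) :
    Measure (Eucl d) :=
  P.map fun ω => x + (X t ω - X 0 ω)

instance {d : ℕ} (P : Measure Ω) [IsFiniteMeasure P] (X : ℝ≥0 → Ω → Eucl d) (t : ℝ≥0)
    (x : Eucl d) : IsFiniteMeasure (transitionFunction P X t x) := by
  unfold transitionFunction; infer_instance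

/-- The coupling time `inf {t ≥ 0 : X_t = X'_t}`, with value `∞` if the processes never meet. -/
def couplingTime {Ω E : Type*} (X X' : ℝ≥0 → Ω → E) (ω : Ω) : ℝ≥0∞ :=
  ⨅ (t : ℝ≥0) (_ : X t ω = X' t ω), (t : ℝ≥0∞)

/-- `X` is a Markov process (for its natural filtration) with càdlàg paths, transition function
`κ` and initial law `μ`. -/
structure IsMarkovProcess {d : ℕ} (P : Measure Ω) (X : ℝ≥0 → Ω → Eucl d)
    (κ : ℝ≥0 → Eucl d → Measure (Eucl d)) (μ : Measure (Eucl d)) : Prop where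
  measurable : ∀ t, Measurable (X t)
  initial : P.map (X 0) = μ
  right_continuous_paths : ∀ᵐ ω ∂P, ∀ t, ContinuousWithinAt (fun t => X t ω) (Ici t) t
  left_limits : ∀ᵐ ω ∂P, ∀ t, ∃ l, Tendsto (fun t => X t ω) (𝓝[<] t) (𝓝 l)
  markov : ∀ (s t : ℝ≥0) (A : Set (Eucl d)), MeasurableSet A →
    P[(X (s + t) ⁻¹' A).indicator (fun _ => (1 : ℝ)) |
        ⨆ (r : ℝ≥0) (_ : r ≤ s), MeasurableSpace.comap (X r) inferInstance]
      =ᵐ[P] fun ω => (κ t (X s ω)).real A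

end Processes

/-- The coupling property of a Markov process with transition function `κ`: for any two initial
laws there is a successful coupling, i.e. two such Markov processes on one probability space with
these initial laws, whose coupling time `T` is a.s. finite. As usual, the paths are càdlàg and the
two processes move together from time `T` on. -/
def HasCouplingProperty {d : ℕ} (κ : ℝ≥0 → Eucl d → Measure (Eucl d)) : Prop :=
  ∀ (μ₁ μ₂ : Measure (Eucl d)) [IsProbabilityMeasure μ₁] [IsProbabilityMeasure μ₂],
    ∃ (Ω : Type u) (_ : MeasurableSpace Ω) (P : Measure Ω) (_ : IsProbabilityMeasure P)
      (X X' : ℝ≥0 → Ω → Eucl d),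
      IsMarkovProcess P X κ μ₁ ∧ IsMarkovProcess P X' κ μ₂ ∧
      ∀ᵐ ω ∂P, couplingTime X X' ω < ∞ ∧ ∀ t : ℝ≥0, couplingTime X X' ω ≤ t → X t ω = X' t ω

/-- The total variation norm `‖μ - ν‖_var` of the signed measure `μ - ν` (at most `2` for
probability measures). -/
def varNorm {E : Type*} [MeasurableSpace E] (μ ν : Measure E) [IsFiniteMeasure μ]
    [IsFiniteMeasure ν] : ℝ≥0∞ :=
  (μ.toSignedMeasure - ν.toSignedMeasure).totalVariation univ

section Reflection

variable {d : ℕ} {Ω : Type v}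

/-- The hyperplane `H_{x,y}` through `(x + y) / 2` with normal vector `x - y`. -/
def mirror (x y : Eucl d) : Set (Eucl d) :=
  {z | inner ℝ (z - (2⁻¹ : ℝ) • (x + y)) (x - y) = 0}

/-- The reflection `R_{x,y}` with respect to `H_{x,y}` (the identity if `x = y`). -/
def reflect (x y z : Eucl d) : Eucl d :=
  z - (2 * inner ℝ (z - (2⁻¹ : ℝ) • (x + y)) (x - y) / ‖x - y‖ ^ 2) • (x - y)

/-- The hitting time `τ_{x,y} = inf {t > 0 : B_t ∈ H_{x,y}}`. -/
def mirrorTime (x y : Eucl d) (B : ℝ≥0 → Ω → Eucl d) (ω : Ω) : ℝ≥0∞ :=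
  ⨅ (t : ℝ≥0) (_ : 0 < t ∧ B t ω ∈ mirror x y), (t : ℝ≥0∞)

open Classical in
/-- The mirror image of `B` up to time `τ_{x,y}`, and `B` itself afterwards. -/
def mirrorProcess (x y : Eucl d) (B : ℝ≥0 → Ω → Eucl d) : ℝ≥0 → Ω → Eucl d :=
  fun t ω => if (t : ℝ≥0∞) ≤ mirrorTime x y B ω then reflect x y (B t ω) else B t ω

/-- The coupling time `T_{x,y}` of the reflection-subordinate coupling
`(B_{S_t}, B̂_{S_t})`, where `B` starts from `x` and `B̂` is its mirror process. -/
def reflectionCouplingTime (x y : Eucl d) (B : ℝ≥0 → Ω → Eucl d) (S : ℝ≥0 → Ω → ℝ≥0) :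
    Ω → ℝ≥0∞ :=
  couplingTime (subordinate B S) (subordinate (mirrorProcess x y B) S)

end Reflection

end SubordinateBM

end

noncomputable section

namespace SubordinateBM

/-! Reflection coupling of Brownian motion survives an independent time change. Three facts carry
the argument.

The mirror process is a Brownian motion for the same filtration as `B` (`IsFilteredBM.mirror`),
hence still independent of `S`. No strong Markov property is used. An increment of the mirror
process is a limit of Riemann sums whose terms are increments of `B`, reflected or not according to
whether the left grid point precedes the hitting time `τ`. That decision belongs to the past and the
reflection is an isometry, so each term has the conditional characteristic function of a Brownian
increment.

The reflection principle (`IsFilteredBM.measure_lt_mirrorTime_le`): being on the starting side of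
the mirror at time `s` splits into `s < τ` and the mirror process being on that side. Hence `P(s <
τ)` is the Gaussian mass of a symmetric interval, at most `|x - y| / (2 √(π s))`, which equals `|x -
y| / (2π) ∫ r^(-1/2) e^(-rs) dr`.

Since `S` is increasing and right-continuous, the subordinate coupling time exceeds `t` exactly when
`S_t < τ` (`lt_reflectionCouplingTime_iff`). Putting `s = S_t` and integrating turns `e^(-rs)` into
`e^(-t f(r))`, which gives (ii) with the coupling inequality `varNorm_le_two_mul`.

For (i), the pair of starting points is drawn from the product of the initial laws, independently of
everything else. The time `τ` is a.s. finite, and `S` is unbounded because `f` is positive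
somewhere, so the processes meet. The Markov property follows from `subordinate_increment`.

For (iii), let `g` be the inverse of `f`. Doubling makes `g` grow at most polynomially, so `r e^(-t
f(r))` is bounded by a multiple of `g(1/t)` for `r > g(1/t)`; for large `r` the logarithmic growth
of `f` takes over. Splitting the integral in (ii) at `g(1/t)` then bounds it by a multiple of
`√g(1/t)`. -/

theorem norm_exp_inner_mul_I {E : Type*} [NormedAddCommGroup E] [InnerProductSpace ℝ E]
    (x y : E) : ‖Complex.exp (inner ℝ x y * Complex.I)‖ = 1 :=
  Complex.norm_exp_ofReal_mul_I _

/-! ### Independence through characteristic functions, and the coupling inequality. -/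

section General

variable {Ω : Type*} {m m0 : MeasurableSpace Ω} {P : Measure Ω} [IsProbabilityMeasure P]
variable {E : Type*} [NormedAddCommGroup E] [InnerProductSpace ℝ E] [MeasurableSpace E]
  [BorelSpace E] [SecondCountableTopology E]

/-- A variable is independent of a σ-algebra once its characteristic function restricted to every
event of the σ-algebra factorizes. -/
theorem indep_of_setIntegral_charFun [CompleteSpace E] {D : Ω → E}
    (hD : Measurable D) {φ : E → ℂ}
    (h : ∀ G, MeasurableSet[m] G → ∀ ξ,
      ∫ ω in G, Complex.exp (inner ℝ (D ω) ξ * Complex.I) ∂P = P.real G * φ ξ) :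
    charFun (P.map D) = φ ∧ Indep m (MeasurableSpace.comap D inferInstance) P := by
  have hexp : ∀ ξ : E, Continuous fun x : E => Complex.exp (inner ℝ x ξ * Complex.I) := by
    intro ξ; fun_prop
  have hφ : charFun (P.map D) = φ := by
    ext ξ
    rw [charFun_apply, integral_map hD.aemeasurable (hexp ξ).aestronglyMeasurable]
    simpa using h univ MeasurableSet.univ ξ
  refine ⟨hφ, ?_⟩
  rw [Indep_iff]
  rintro G _ hG ⟨A, hA, rfl⟩
  -- Finite measures are determined by their characteristic functions, so the law of `D` on the
  -- event `G` is a multiple of its full law.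
  have key : (P.restrict G).map D = P G • P.map D := by
    have : IsFiniteMeasure (P G • P.map D) := Measure.smul_finite _ (measure_ne_top _ _)
    apply Measure.ext_of_charFun
    ext ξ
    rw [charFun_apply, integral_map hD.aemeasurable (hexp ξ).aestronglyMeasurable, h G hG,
      ← hφ, charFun_apply, charFun_apply, integral_smul_measure]
    simp [Measure.real]
  have := congrArg (fun μ : Measure E => μ A) key
  simp only [Measure.smul_apply, smul_eq_mul] at this
  rw [Measure.map_apply hD hA, Measure.map_apply hD hA, Measure.restrict_apply (hD hA)] at this
  rw [inter_comm, this]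

variable {α β : Type*} [MeasurableSpace α] [MeasurableSpace β]

theorem IndepFun.lintegral_prod_eq {X : Ω → α} {Y : Ω → β} (h : IndepFun X Y P)
    (hX : Measurable X) (hY : Measurable Y) {F : α × β → ℝ≥0∞} (hF : Measurable F) :
    ∫⁻ ω, F (X ω, Y ω) ∂P = ∫⁻ ω, ∫⁻ ω', F (X ω', Y ω) ∂P ∂P := by
  have := Measure.isProbabilityMeasure_map (μ := P) hX.aemeasurable
  have := Measure.isProbabilityMeasure_map (μ := P) hY.aemeasurable
  rw [← lintegral_map (f := F) (g := fun ω => (X ω, Y ω)) hF (hX.prodMk hY),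
    (indepFun_iff_map_prod_eq_prod_map_map hX.aemeasurable hY.aemeasurable).1 h,
    lintegral_prod_symm' _ hF, lintegral_map (Measurable.lintegral_prod_left' hF) hY]
  refine lintegral_congr fun ω => ?_
  exact lintegral_map (hF.comp (measurable_id.prodMk measurable_const)) hX

theorem IndepFun.integral_prod_eq {X : Ω → α} {Y : Ω → β} (h : IndepFun X Y P)
    (hX : Measurable X) (hY : Measurable Y) {F : α × β → ℂ} (hF : Measurable F) {C : ℝ}
    (hC : ∀ p, ‖F p‖ ≤ C) :
    ∫ ω, F (X ω, Y ω) ∂P = ∫ ω, ∫ ω', F (X ω, Y ω') ∂P ∂P := by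
  have := Measure.isProbabilityMeasure_map (μ := P) hX.aemeasurable
  have := Measure.isProbabilityMeasure_map (μ := P) hY.aemeasurable
  have hsm : StronglyMeasurable F := hF.stronglyMeasurable
  rw [← integral_map (f := F) (φ := fun ω => (X ω, Y ω)) (hX.prodMk hY).aemeasurable
      hF.aestronglyMeasurable,
    (indepFun_iff_map_prod_eq_prod_map_map hX.aemeasurable hY.aemeasurable).1 h,
    integral_prod _ (Integrable.of_bound hF.aestronglyMeasurable C (ae_of_all _ hC)),
    integral_map hX.aemeasurable hsm.integral_prod_right'.aestronglyMeasurable]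
  refine integral_congr_ae (ae_of_all _ fun ω => ?_)
  exact integral_map hY.aemeasurable
    (hF.comp (measurable_const.prodMk measurable_id)).aestronglyMeasurable

theorem IndepFun.integral_prod_eq' {X : Ω → α} {Y : Ω → β} (h : IndepFun X Y P)
    (hX : Measurable X) (hY : Measurable Y) {F : α × β → ℂ} (hF : Measurable F) {C : ℝ}
    (hC : ∀ p, ‖F p‖ ≤ C) :
    ∫ ω, F (X ω, Y ω) ∂P = ∫ ω, ∫ ω', F (X ω', Y ω) ∂P ∂P :=
  IndepFun.integral_prod_eq h.symm hY hX (F := fun p => F p.swap) (hF.comp measurable_swap)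
    fun p => hC p.swap

/-- Conditional characteristic function of a variable independent of a σ-algebra, evaluated at a
random frequency. -/
theorem integral_mul_exp_of_indep (hm : m ≤ m0) {D : Ω → E}
    (hD : Measurable D) (h : Indep m (MeasurableSpace.comap D inferInstance) P)
    {Z : Ω → ℂ} {V : Ω → E} (hZ : Measurable[m] Z) (hV : Measurable[m] V) (hZ1 : ∀ ω, ‖Z ω‖ ≤ 1) :
    ∫ ω, Z ω * Complex.exp (inner ℝ (D ω) (V ω) * Complex.I) ∂P =
      ∫ ω, Z ω * charFun (P.map D) (V ω) ∂P := by
  have hZV : Measurable[m] fun ω => (Z ω, V ω) := hZ.prodMk hV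
  have hind : IndepFun (fun ω => (Z ω, V ω)) D P := by
    rw [IndepFun_iff_Indep]
    exact indep_of_indep_of_le_left h hZV.comap_le
  -- `IndepFun.integral_prod_eq` needs an integrand bounded on the whole product space; the
  -- truncation provides this and leaves `Z` unchanged.
  let c : ℂ → ℂ := fun z => if ‖z‖ ≤ 1 then z else 0
  have hc : Measurable c :=
    Measurable.ite (measurableSet_le measurable_norm measurable_const) measurable_id
      measurable_const
  have hcZ : ∀ ω, c (Z ω) = Z ω := fun ω => if_pos (hZ1 ω)
  have hc1 : ∀ z, ‖c z‖ ≤ 1 := by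
    intro z
    by_cases hz : ‖z‖ ≤ 1 <;> simp [c, hz]
  have hF : Measurable fun p : (ℂ × E) × E =>
      c p.1.1 * Complex.exp (inner ℝ p.2 p.1.2 * Complex.I) := by
    refine (hc.comp (measurable_fst.comp measurable_fst)).mul ?_
    have : Continuous fun p : (ℂ × E) × E => Complex.exp (inner ℝ p.2 p.1.2 * Complex.I) := by
      fun_prop
    exact this.measurable
  have := IndepFun.integral_prod_eq hind (hZV.mono hm le_rfl) hD hF (C := 1) (fun p => by
    rw [norm_mul, norm_exp_inner_mul_I, mul_one]; exact hc1 _)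
  simp only [hcZ] at this
  rw [this]
  refine integral_congr_ae (ae_of_all _ fun ω => ?_)
  have hexp : Continuous fun x : E => Complex.exp (inner ℝ x (V ω) * Complex.I) := by
    fun_prop
  simp only
  rw [integral_const_mul, charFun_apply, integral_map hD.aemeasurable hexp.aestronglyMeasurable]

/-- The coupling inequality for the total variation norm. -/
theorem varNorm_le_two_mul {X Y : Ω → α} (hX : Measurable X) (hY : Measurable Y)
    (μ ν : Measure α) [IsFiniteMeasure μ] [IsFiniteMeasure ν] (hμ : P.map X = μ)
    (hν : P.map Y = ν) {p : ℝ≥0∞} (hp : P {ω | X ω ≠ Y ω} ≤ p) : varNorm μ ν ≤ 2 * p := by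
  subst hμ hν
  have key : ∀ {X Y : Ω → α}, Measurable X → Measurable Y → P {ω | X ω ≠ Y ω} ≤ p →
      ∀ A, MeasurableSet A →
      ENNReal.ofReal ((P.map X).real A - (P.map Y).real A) ≤ p := by
    intro X Y hX hY hp A hA
    rw [map_measureReal_apply hX hA, map_measureReal_apply hY hA]
    refine le_trans ?_ hp
    rw [← ofReal_measureReal]
    refine ENNReal.ofReal_le_ofReal ?_
    rw [sub_le_iff_le_add]
    refine (measureReal_mono ?_).trans (measureReal_union_le _ _)
    intro ω hω
    by_cases h : X ω = Y ω
    · right; simpa [← h] using hω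
    · exact Or.inl h
  -- On a Hahn set `i` and its complement the positive and negative parts are differences of
  -- probabilities of one event, each at most `p`.
  obtain ⟨i, hi₁, hi₂, hi₃, hpos, hneg⟩ :=
    ((P.map X).toSignedMeasure - (P.map Y).toSignedMeasure).toJordanDecomposition_spec
  have hval : ∀ A, MeasurableSet A →
      ((P.map X).toSignedMeasure - (P.map Y).toSignedMeasure) A =
        (P.map X).real A - (P.map Y).real A := by
    intro A hA
    rw [_root_.sub_apply, Measure.toSignedMeasure_apply_measurable hA,
      Measure.toSignedMeasure_apply_measurable hA]
  rw [varNorm, SignedMeasure.totalVariation, Measure.add_apply, hpos, hneg,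
    SignedMeasure.toMeasureOfZeroLE_apply _ hi₂ hi₁ MeasurableSet.univ,
    SignedMeasure.toMeasureOfLEZero_apply _ hi₃ hi₁.compl MeasurableSet.univ, two_mul]
  refine add_le_add ?_ ?_
  · refine le_trans (le_of_eq ?_) (key hX hY hp i hi₁)
    rw [ENNReal.coe_nnreal_eq, NNReal.coe_mk, inter_univ, hval i hi₁]
  · refine le_trans (le_of_eq ?_) (key hY hX (by simpa only [ne_comm] using hp) _ hi₁.compl)
    rw [ENNReal.coe_nnreal_eq, NNReal.coe_mk, inter_univ, hval _ hi₁.compl, neg_sub]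

end General

/-! ### Modification of the paths on a null set. -/

section Regular

variable {Ω : Type*} [MeasurableSpace Ω] {P : Measure Ω} {d : ℕ}
  {B B' : ℝ≥0 → Ω → Eucl d} {S S' : ℝ≥0 → Ω → ℝ≥0} {f : ℝ → ℝ}

/-- All paths (and not only almost all) of the Brownian motion and of the subordinator are
regular. -/
structure RegularPaths (B : ℝ≥0 → Ω → Eucl d) (S : ℝ≥0 → Ω → ℝ≥0) : Prop where
  continuous : ∀ ω, Continuous fun t => B t ω
  start : ∀ ω, S 0 ω = 0
  monotone : ∀ ω, Monotone fun t => S t ω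
  right_continuous : ∀ ω t, ContinuousWithinAt (fun t => S t ω) (Ici t) t

theorem IsSubordination.congr (h : IsSubordination P B S f) (hB : ∀ t, Measurable (B' t))
    (hS : ∀ t, Measurable (S' t)) (hBB : ∀ᵐ ω ∂P, ∀ t, B t ω = B' t ω)
    (hSS : ∀ᵐ ω ∂P, ∀ t, S t ω = S' t ω) : IsSubordination P B' S' f where
  brownian :=
    { measurable := hB
      continuous_paths := by
        filter_upwards [h.brownian.continuous_paths, hBB] with ω h1 h2
        simpa only [← h2] using h1
      indep_increments := fun s t => by
        refine (h.brownian.indep_increments s t).congr ?_ ?_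
        · filter_upwards [hBB] with ω h2
          rw [h2, h2]
        · filter_upwards [hBB] with ω h2
          funext r
          exact h2 r
      charFun_increments := fun s t ξ => by
        rw [← h.brownian.charFun_increments s t ξ]
        congr 1
        refine Measure.map_congr ?_
        filter_upwards [hBB] with ω h2
        rw [h2, h2] }
  subordinator :=
    { measurable := hS
      start := by
        filter_upwards [h.subordinator.start, hSS] with ω h1 h2
        rw [← h2, h1]
      monotone_paths := by
        filter_upwards [h.subordinator.monotone_paths, hSS] with ω h1 h2
        simpa only [← h2] using h1
      right_continuous_paths := by
        filter_upwards [h.subordinator.right_continuous_paths, hSS] with ω h1 h2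
        simpa only [← h2] using h1
      indep_increments := fun s t => by
        refine (h.subordinator.indep_increments s t).congr ?_ ?_
        · filter_upwards [hSS] with ω h2
          rw [h2, h2]
        · filter_upwards [hSS] with ω h2
          funext r
          exact h2 r
      stationary_increments := fun s t => by
        have h1 : (fun ω => (S (s + t) ω : ℝ) - S s ω) =ᵐ[P]
            fun ω => (S' (s + t) ω : ℝ) - S' s ω := by
          filter_upwards [hSS] with ω h2
          rw [h2, h2]
        have h3 : (fun ω => (S t ω : ℝ)) =ᵐ[P] fun ω => (S' t ω : ℝ) := by
          filter_upwards [hSS] with ω h2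
          rw [h2]
        have h4 := h.subordinator.stationary_increments s t
        refine ⟨h4.aemeasurable_fst.congr h1, h4.aemeasurable_snd.congr h3, ?_⟩
        rw [← Measure.map_congr h1, ← Measure.map_congr h3]
        exact h4.map_eq }
  laplace := fun t lam hl => by
    rw [← h.laplace t lam hl]
    congr 1
    refine Measure.map_congr ?_
    filter_upwards [hSS] with ω h2
    rw [h2]
  indep := by
    refine h.indep.congr ?_ ?_
    · filter_upwards [hBB] with ω h2
      funext r
      exact h2 r
    · filter_upwards [hSS] with ω h2
      funext r
      exact h2 r

/-- The paths can be made regular by a modification on a null set; almost sure properties of the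
Brownian path that hold for a constant path can be assumed to hold everywhere. -/
theorem IsSubordination.exists_regular (h : IsSubordination P B S f) (c : Eucl d)
    (p : (ℝ≥0 → Eucl d) → Prop) (hpc : p fun _ => c) (hp : ∀ᵐ ω ∂P, p fun t => B t ω) :
    ∃ (B' : ℝ≥0 → Ω → Eucl d) (S' : ℝ≥0 → Ω → ℝ≥0), IsSubordination P B' S' f ∧
      RegularPaths B' S' ∧ (∀ ω, p fun t => B' t ω) ∧ (∀ᵐ ω ∂P, ∀ t, B t ω = B' t ω) ∧
      (∀ᵐ ω ∂P, ∀ t, S t ω = S' t ω) := by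
  classical
  have hall : ∀ᵐ ω ∂P, (Continuous fun t => B t ω) ∧ S 0 ω = 0 ∧ (Monotone fun t => S t ω) ∧
      (∀ t, ContinuousWithinAt (fun t => S t ω) (Ici t) t) ∧ p fun t => B t ω := by
    filter_upwards [h.brownian.continuous_paths, h.subordinator.start,
      h.subordinator.monotone_paths, h.subordinator.right_continuous_paths,
          hp] with ω h1 h2 h3 h4 h5
    exact ⟨h1, h2, h3, h4, h5⟩
  obtain ⟨N, hN, hNm, hN0⟩ := exists_measurable_superset_of_null (ae_iff.1 hall)
  have hgood : ∀ ω, ω ∉ N → _ := fun ω hω => not_not.1 fun h' => hω (hN h')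
  have hNae : ∀ᵐ ω ∂P, ω ∉ N := measure_eq_zero_iff_ae_notMem.1 hN0
  let B' : ℝ≥0 → Ω → Eucl d := fun t ω => if ω ∈ N then c else B t ω
  let S' : ℝ≥0 → Ω → ℝ≥0 := fun t ω => if ω ∈ N then 0 else S t ω
  have hB' : ∀ᵐ ω ∂P, ∀ t, B t ω = B' t ω := by
    filter_upwards [hNae] with ω hω t
    simp [B', hω]
  have hS' : ∀ᵐ ω ∂P, ∀ t, S t ω = S' t ω := by
    filter_upwards [hNae] with ω hω t
    simp [S', hω]
  refine ⟨B', S', h.congr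
    (fun t => Measurable.ite hNm measurable_const (h.brownian.measurable t))
    (fun t => Measurable.ite hNm measurable_const (h.subordinator.measurable t)) hB' hS',
    ⟨fun ω => ?_, fun ω => ?_, fun ω => ?_, fun ω => ?_⟩, fun ω => ?_, hB', hS'⟩
  all_goals
    by_cases hω : ω ∈ N
    · simp [B', S', hω, continuous_const, monotone_const, continuousWithinAt_const, hpc]
    · have := hgood ω hω
      simp only [B', S', hω, if_false]
      tauto

end Regular

/-! ### Increments of the subordinate process. -/

section Subordination

variable {Ω : Type*} [MeasurableSpace Ω] {P : Measure Ω} {d : ℕ}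
  {B : ℝ≥0 → Ω → Eucl d} {S : ℝ≥0 → Ω → ℝ≥0} {f : ℝ → ℝ}

/-- Continuous paths in `ℝ^d`, with the σ-algebra generated by the evaluations. -/
abbrev ContPath (d : ℕ) : Type := {w : ℝ≥0 → Eucl d // Continuous w}

/-- Continuity of the paths makes evaluation jointly measurable in path and time; on the space of
all paths this fails, and `B` could not be evaluated at the random time `S_t`. -/
theorem measurable_contPath_eval :
    Measurable fun p : ContPath d × ℝ≥0 => p.1.1 p.2 := by
  have h : Measurable (Function.uncurry fun (u : ℝ≥0) (w : ContPath d) => w.1 u) :=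
    measurable_uncurry_of_continuous_of_measurable (fun w => w.2)
      fun u => (measurable_pi_apply u).comp measurable_subtype_coe
  exact h.comp measurable_swap

theorem measurable_eval_comp {α : Type*} [MeasurableSpace α] {w : α → ContPath d} {u : α → ℝ≥0}
    (hw : Measurable w) (hu : Measurable u) : Measurable fun a => (w a).1 (u a) :=
  measurable_contPath_eval.comp (hw.prodMk hu)

/-- The Brownian motion as a random element of the path space. -/
def pathOf (B : ℝ≥0 → Ω → Eucl d) (hB : ∀ ω, Continuous fun t => B t ω) (ω : Ω) : ContPath d :=
  ⟨fun t => B t ω, hB ω⟩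

theorem measurable_pathOf (hB : ∀ ω, Continuous fun t => B t ω) (hm : ∀ t, Measurable (B t)) :
    Measurable (pathOf B hB) :=
  Measurable.subtype_mk (measurable_pi_lambda _ hm)

theorem measurable_subordinate (hX : IsSubordination P B S f) (hr : RegularPaths B S) (t : ℝ≥0) :
    Measurable (subordinate B S t) :=
  measurable_eval_comp (measurable_pathOf hr.continuous hX.brownian.measurable)
    (hX.subordinator.measurable t)

theorem indepFun_pathOf (hX : IsSubordination P B S f) (hr : RegularPaths B S) :
    IndepFun (pathOf B hr.continuous) (fun ω t => S t ω) P := by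
  have h := hX.indep
  rw [IndepFun_iff_Indep] at h ⊢
  refine indep_of_indep_of_le_left h ?_
  rintro _ ⟨s, ⟨s', hs', rfl⟩, rfl⟩
  exact ⟨s', hs', rfl⟩

/-- The characteristic function of the increments of the subordinate Brownian motion. -/
def subordinateCharFun (f : ℝ → ℝ) (t : ℝ≥0) (ξ : Eucl d) : ℂ :=
  -- The value `f 0` carries no information, so frequency zero is treated apart.
  if ξ = 0 then 1 else Complex.exp (-((t : ℝ) * f (‖ξ‖ ^ 2) : ℝ))

theorem integral_exp_subordinator [IsProbabilityMeasure P] (hX : IsSubordination P B S f)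
    (t : ℝ≥0) (ξ : Eucl d) :
    ∫ ω, Complex.exp (-((S t ω : ℝ) * ‖ξ‖ ^ 2 : ℝ)) ∂P = subordinateCharFun f t ξ := by
  rw [subordinateCharFun]
  split_ifs with hξ
  · simp [hξ]
  · have hpos : 0 < ‖ξ‖ ^ 2 := by positivity
    have h := hX.laplace t _ hpos
    rw [integral_map (hX.subordinator.measurable t).aemeasurable
      (by fun_prop : Measurable fun s : ℝ≥0 => _).aestronglyMeasurable] at h
    have h2 : ∀ ω, Complex.exp (-((S t ω : ℝ) * ‖ξ‖ ^ 2 : ℝ)) =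
        ((Real.exp (-(‖ξ‖ ^ 2 * (S t ω : ℝ))) : ℝ) : ℂ) := by
      intro ω
      rw [mul_comm]; push_cast; rfl
    simp_rw [h2]
    rw [integral_complex_ofReal, h]
    push_cast; rfl

/-- The increments of `X = B_S` have a deterministic characteristic function, also when restricted
to an event of the past of `X`. -/
theorem setIntegral_exp_subordinate [IsProbabilityMeasure P] (hX : IsSubordination P B S f)
    (hr : RegularPaths B S) (s t : ℝ≥0) {Γ : Set (Iic s → Eucl d)} (hΓ : MeasurableSet Γ)
        (ξ : Eucl d) :
    ∫ ω in (fun ω (r : Iic s) => subordinate B S r ω) ⁻¹' Γ,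
      Complex.exp (inner ℝ (subordinate B S (s + t) ω - subordinate B S s ω) ξ * Complex.I) ∂P =
    P.real ((fun ω (r : Iic s) => subordinate B S r ω) ⁻¹' Γ) * subordinateCharFun f t ξ := by
  set W := pathOf B hr.continuous with hWdef
  have hW : Measurable W := measurable_pathOf _ hX.brownian.measurable
  set σ : Ω → ℝ≥0 → ℝ≥0 := fun ω t => S t ω with hσdef
  have hσ : Measurable σ := measurable_pi_lambda _ hX.subordinator.measurable
  have hind : IndepFun W σ P := indepFun_pathOf hX hr
  have hXm := measurable_subordinate hX hr
  let one : (Iic s → Eucl d) → ℂ := Γ.indicator fun _ => 1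
  have hone : Measurable one := measurable_const.indicator hΓ
  have hone1 : ∀ y, ‖one y‖ ≤ 1 := fun y => by
    by_cases hy : y ∈ Γ <;> simp [one, hy]
  -- evaluations on the product of the path spaces
  have hev : ∀ r : ℝ≥0, Measurable fun p : ContPath d × (ℝ≥0 → ℝ≥0) => p.1.1 (p.2 r) := fun r =>
    measurable_eval_comp measurable_fst ((measurable_pi_apply r).comp measurable_snd)
  have hpast : Measurable fun p : ContPath d × (ℝ≥0 → ℝ≥0) => one fun r : Iic s => p.1.1 (p.2 r) :=
    hone.comp (measurable_pi_lambda _ fun r => hev r)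
  have hexpm : Measurable fun x : Eucl d => Complex.exp (inner ℝ x ξ * Complex.I) := by
    have : Continuous fun x : Eucl d => Complex.exp (inner ℝ x ξ * Complex.I) := by fun_prop
    exact this.measurable
  let F : ContPath d × (ℝ≥0 → ℝ≥0) → ℂ := fun p => one (fun r : Iic s => p.1.1 (p.2 r)) *
    Complex.exp (inner ℝ (p.1.1 (p.2 (s + t)) - p.1.1 (p.2 s)) ξ * Complex.I)
  have hF : Measurable F := hpast.mul (hexpm.comp ((hev _).sub (hev _)))
  have hF1 : ∀ p, ‖F p‖ ≤ 1 := fun p => by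
    rw [norm_mul, norm_exp_inner_mul_I, mul_one]; exact hone1 _
  -- `F` with the exponential replaced by its mean for fixed times. The truncated subtraction keeps
  -- `F'` bounded by one also at time paths that are not monotone.
  let F' : ContPath d × (ℝ≥0 → ℝ≥0) → ℂ := fun p => one (fun r : Iic s => p.1.1 (p.2 r)) *
    Complex.exp (-(((p.2 (s + t) - p.2 s : ℝ≥0) : ℝ) * ‖ξ‖ ^ 2 : ℝ))
  have hF' : Measurable F' := by
    refine hpast.mul ?_
    have h1 : Measurable fun p : ContPath d × (ℝ≥0 → ℝ≥0) => p.2 (s + t) - p.2 s :=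
      ((measurable_pi_apply _).comp measurable_snd).sub
          ((measurable_pi_apply _).comp measurable_snd)
    fun_prop
  have hF'1 : ∀ p, ‖F' p‖ ≤ 1 := fun p => by
    rw [norm_mul]
    refine mul_le_one₀ (hone1 _) (norm_nonneg _) ?_
    rw [← Complex.ofReal_neg, Complex.norm_exp_ofReal, Real.exp_le_one_iff, neg_nonpos]
    positivity
  have hL : ∫ ω in (fun ω (r : Iic s) => subordinate B S r ω) ⁻¹' Γ,
      Complex.exp (inner ℝ (subordinate B S (s + t) ω - subordinate B S s ω) ξ * Complex.I) ∂P =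
      ∫ ω, F (W ω, σ ω) ∂P := by
    rw [← integral_indicator (measurable_pi_lambda _ (fun r : Iic s => hXm r) hΓ)]
    refine integral_congr_ae (ae_of_all _ fun ω => ?_)
    by_cases hω : (fun r : Iic s => subordinate B S r ω) ∈ Γ
    · have h2 : one (fun r : Iic s => subordinate B S r ω) = 1 := indicator_of_mem hω _
      rw [indicator_of_mem (s := (fun ω (r : Iic s) => subordinate B S r ω) ⁻¹' Γ) hω]
      exact (one_mul _).symm.trans (congrArg (· * _) h2.symm)
    · have h2 : one (fun r : Iic s => subordinate B S r ω) = 0 := indicator_of_notMem hω _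
      rw [indicator_of_notMem (s := (fun ω (r : Iic s) => subordinate B S r ω) ⁻¹' Γ) hω]
      exact (zero_mul _).symm.trans (congrArg (· * _) h2.symm)
  -- integrate out the Brownian increment for a frozen path of the subordinator
  have hstep1 : ∀ ω', ∫ ω, F (W ω, σ ω') ∂P = ∫ ω, F' (W ω, σ ω') ∂P := by
    intro ω'
    have hmono := hr.monotone ω'
    let u := S s ω'
    let h := S (s + t) ω' - u
    have huh : u + h = S (s + t) ω' := add_tsub_cancel_of_le (hmono (by simp))
    have hBi := hX.brownian.indep_increments u h
    rw [IndepFun_iff_Indep] at hBi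
    let past : Ω → Iic u → Eucl d := fun ω r => B r ω
    have hpastm : Measurable past := measurable_pi_lambda _ fun r => hX.brownian.measurable r
    have hZ : Measurable[MeasurableSpace.comap past inferInstance] fun ω =>
        one fun r : Iic s => B (S r ω') ω := by
      let g : (Iic u → Eucl d) → (Iic s → Eucl d) := fun w r => w ⟨S r ω', hmono r.2⟩
      have hg : Measurable (one ∘ g) :=
        hone.comp (measurable_pi_lambda _ fun r => measurable_pi_apply _)
      exact hg.comp (comap_measurable past)
    have := integral_mul_exp_of_indep (P := P) hpastm.comap_le
      ((hX.brownian.measurable (u + h)).sub (hX.brownian.measurable u)) hBi.symm hZ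
      (V := fun _ => ξ) measurable_const fun ω => hone1 _
    have h3 := hX.brownian.charFun_increments u h ξ
    simp only [Pi.sub_def] at this
    rw [h3] at this
    rw [huh] at this
    exact this
  -- integrate out the increment of the subordinator for a frozen Brownian path
  have hstep2 : ∀ ω, ∫ ω', F' (W ω, σ ω') ∂P =
      (∫ ω', one (fun r : Iic s => B (S r ω') ω) ∂P) * subordinateCharFun f t ξ := by
    intro ω
    let past : Ω → Iic s → ℝ≥0 := fun ω r => S r ω
    have hi := hX.subordinator.indep_increments s t
    let g1 : (Iic s → ℝ≥0) → ℂ := fun σ => one fun r => B (σ r) ω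
    have hg1 : Measurable g1 := hone.comp (measurable_pi_lambda _ fun r =>
      (hr.continuous ω).measurable.comp (measurable_pi_apply r))
    let g2 : ℝ → ℂ := fun x => Complex.exp (-(x * ‖ξ‖ ^ 2 : ℝ))
    have hg2 : Measurable g2 := by fun_prop
    have hi' := (hi.comp hg2 hg1).symm
    have hpm : Measurable past := measurable_pi_lambda _ fun r => hX.subordinator.measurable r
    have him : Measurable fun ω' => (S (s + t) ω' : ℝ) - S s ω' :=
      ((hX.subordinator.measurable _).coe_nnreal_real).sub
        ((hX.subordinator.measurable _).coe_nnreal_real)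
    have h1 := hi'.integral_fun_mul_eq_mul_integral (hg1.comp hpm).aestronglyMeasurable
      (hg2.comp him).aestronglyMeasurable
    have h2 : ∫ ω', g2 ((S (s + t) ω' : ℝ) - S s ω') ∂P = subordinateCharFun f t ξ := by
      rw [← integral_exp_subordinator hX t ξ]
      exact ((hX.subordinator.stationary_increments s t).comp hg2).integral_eq
    simp only [Function.comp_apply] at h1
    rw [h2] at h1
    rw [← h1]
    refine integral_congr_ae (ae_of_all _ fun ω' => ?_)
    have hle : S s ω' ≤ S (s + t) ω' := hr.monotone ω' (by simp)
    simp only [F', g1, g2]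
    rw [← NNReal.coe_sub hle]
    rfl
  -- Freeze the path of `S` to pass from `F` to `F'`, then exchange the order of integration and
  -- freeze the path of `B`.
  rw [hL, IndepFun.integral_prod_eq' hind hW hσ hF hF1]
  simp_rw [hstep1]
  rw [← IndepFun.integral_prod_eq' hind hW hσ hF' hF'1,
    IndepFun.integral_prod_eq hind hW hσ hF' hF'1]
  simp_rw [hstep2]
  rw [integral_mul_const]
  congr 1
  have h4 := IndepFun.integral_prod_eq hind hW hσ hpast (C := 1) fun p => hone1 _
  rw [← integral_indicator_one (measurable_pi_lambda _ (fun r : Iic s => hXm r) hΓ),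
    ← integral_complex_ofReal]
  refine h4.symm.trans (integral_congr_ae (ae_of_all _ fun ω => ?_))
  beta_reduce
  by_cases hω : (fun r : Iic s => subordinate B S r ω) ∈ Γ
  · have h2 : one (fun r : Iic s => subordinate B S r ω) = 1 := indicator_of_mem hω _
    rw [indicator_of_mem (s := (fun ω (r : Iic s) => subordinate B S r ω) ⁻¹' Γ) hω]
    exact h2.trans (by simp)
  · have h2 : one (fun r : Iic s => subordinate B S r ω) = 0 := indicator_of_notMem hω _
    rw [indicator_of_notMem (s := (fun ω (r : Iic s) => subordinate B S r ω) ⁻¹' Γ) hω]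
    exact h2.trans (by simp)

end Subordination

/-- Links the past in the definition of a Markov process with the past generated by the restricted
path. -/
theorem iSup_comap_le_eq_comap {Ω E : Type*} [MeasurableSpace E] (X : ℝ≥0 → Ω → E) (s : ℝ≥0) :
    (⨆ (r : ℝ≥0) (_ : r ≤ s), MeasurableSpace.comap (X r) inferInstance) =
      MeasurableSpace.comap (fun ω (r : Iic s) => X r ω) inferInstance := by
  rw [MeasurableSpace.pi, MeasurableSpace.comap_iSup, iSup_subtype]
  simp only [MeasurableSpace.comap_comp]
  rfl

/-! ### Markov property and transition function. -/

section Markov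

variable {Ω : Type*} [MeasurableSpace Ω] {P : Measure Ω} {d : ℕ}
  {B : ℝ≥0 → Ω → Eucl d} {S : ℝ≥0 → Ω → ℝ≥0} {f : ℝ → ℝ}

theorem measurable_map_add_apply [IsProbabilityMeasure P] (D : Ω → Eucl d) (hD : Measurable D)
    {A : Set (Eucl d)}
    (hA : MeasurableSet A) : Measurable fun x => P.map (fun ω => x + D ω) A := by
  have h : ∀ x, P.map (fun ω => x + D ω) A = P (Prod.mk x ⁻¹' {p : Eucl d × Ω | p.1 + D p.2 ∈ A}) :=
    fun x => Measure.map_apply (measurable_const.add hD) hA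
  simp_rw [h]
  refine measurable_measure_prodMk_left ?_
  exact (measurable_fst.add (hD.comp measurable_snd)) hA

/-- Markov property of a process with an increment that is independent of the past. -/
theorem condExp_indicator_add {Ω : Type*} {m m0 : MeasurableSpace Ω} {P : Measure Ω}
    [IsProbabilityMeasure P]
    (hm : m ≤ m0) {X D : Ω → Eucl d} (hX : Measurable[m] X) (hD : Measurable D)
    (h : Indep m (MeasurableSpace.comap D inferInstance) P) {A : Set (Eucl d)}
    (hA : MeasurableSet A) :
    P[((fun ω => X ω + D ω) ⁻¹' A).indicator (fun _ => (1 : ℝ)) | m] =ᵐ[P]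
      fun ω => (P.map fun ω' => X ω + D ω').real A := by
  have hXD : Measurable fun ω => X ω + D ω := (hX.mono hm le_rfl).add hD
  have hκ : Measurable fun x => P.map (fun ω => x + D ω) A := measurable_map_add_apply D hD hA
  have hκm : Measurable[m] fun ω => (P.map fun ω' => X ω + D ω').real A :=
    (hκ.ennreal_toReal).comp hX
  have hle : ∀ x, P.map (fun ω' => x + D ω') A ≤ 1 := fun x => by
    have := Measure.isProbabilityMeasure_map (μ := P) (f := fun ω' => x + D ω')
      (measurable_const.add hD).aemeasurable
    exact prob_le_one
  have hint : Integrable (fun ω => (P.map fun ω' => X ω + D ω').real A) P := by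
    refine Integrable.of_bound (hκm.mono hm le_rfl).aestronglyMeasurable 1 (ae_of_all _ fun ω => ?_)
    rw [Real.norm_of_nonneg measureReal_nonneg]
    exact ENNReal.toReal_le_of_le_ofReal zero_le_one (by simpa using hle _)
  refine (ae_eq_condExp_of_forall_setIntegral_eq hm ?_ (fun _ _ _ => hint.integrableOn) ?_
    (hκm.stronglyMeasurable.aestronglyMeasurable)).symm
  · exact (integrable_const 1).indicator (hXD hA)
  intro G hG _
  have hG0 := hm _ hG
  rw [integral_indicator (hXD hA)]
  simp only [integral_const, smul_eq_mul, mul_one, measureReal_restrict_apply_univ]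
  rw [measureReal_restrict_apply (hXD hA)]
  simp only [Measure.real]
  rw [integral_toReal (f := fun ω => P.map (fun ω' => X ω + D ω') A)
    ((hκ.comp (hX.mono hm le_rfl)).aemeasurable)
    (ae_of_all _ fun ω => (hle _).trans_lt ENNReal.one_lt_top)]
  congr 1
  -- Coding the event `G` by its indicator turns all the required past information into one variable
  -- independent of `D`.
  have hpair : Measurable[m] fun ω => (G.indicator (fun _ => (1 : ℝ≥0∞)) ω, X ω) :=
    (measurable_const.indicator hG).prodMk hX
  have hind : IndepFun D (fun ω => (G.indicator (fun _ => (1 : ℝ≥0∞)) ω, X ω)) P := by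
    rw [IndepFun_iff_Indep]
    exact (indep_of_indep_of_le_left h hpair.comap_le).symm
  have hF : Measurable fun p : Eucl d × (ℝ≥0∞ × Eucl d) =>
      p.2.1 * A.indicator (fun _ => (1 : ℝ≥0∞)) (p.2.2 + p.1) := by
    refine (measurable_fst.comp measurable_snd).mul ?_
    exact (measurable_const.indicator hA).comp
      ((measurable_snd.comp measurable_snd).add measurable_fst)
  have key := IndepFun.lintegral_prod_eq hind hD (hpair.mono hm le_rfl) hF
  have hR : ∀ ω, ∫⁻ ω', G.indicator (fun _ => (1 : ℝ≥0∞)) ω *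
      A.indicator (fun _ => (1 : ℝ≥0∞)) (X ω + D ω') ∂P =
      G.indicator (fun ω => P.map (fun ω' => X ω + D ω') A) ω := by
    intro ω
    have hmeas : Measurable fun ω' => X ω + D ω' := measurable_const.add hD
    rw [lintegral_const_mul (f := fun ω' => A.indicator (fun _ => (1 : ℝ≥0∞)) (X ω + D ω')) _
        ((measurable_const.indicator hA).comp hmeas)]
    have : (fun ω' => A.indicator (fun _ => (1 : ℝ≥0∞)) (X ω + D ω')) =
        ((fun ω' => X ω + D ω') ⁻¹' A).indicator 1 := by
      rfl
    rw [this, lintegral_indicator_one (hmeas hA)]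
    by_cases hω : ω ∈ G <;> simp [hω, Measure.map_apply hmeas hA]
  have hLL : ∀ ω, G.indicator (fun _ => (1 : ℝ≥0∞)) ω *
      A.indicator (fun _ => (1 : ℝ≥0∞)) (X ω + D ω) =
      ((fun ω => X ω + D ω) ⁻¹' A ∩ G).indicator 1 ω := by
    intro ω
    by_cases h1 : ω ∈ G <;> by_cases h2 : X ω + D ω ∈ A <;> simp [h1, h2, indicator]
  simp only [hR, hLL] at key
  rw [lintegral_indicator_one ((hXD hA).inter hG0), lintegral_indicator hG0] at key
  exact key.symm

theorem subordinate_increment [IsProbabilityMeasure P] (hX : IsSubordination P B S f)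
    (hr : RegularPaths B S) (s t : ℝ≥0) :
    charFun (P.map fun ω => subordinate B S (s + t) ω - subordinate B S s ω) =
      subordinateCharFun f t ∧
    Indep (⨆ (r : ℝ≥0) (_ : r ≤ s), MeasurableSpace.comap (subordinate B S r) inferInstance)
      (MeasurableSpace.comap (fun ω => subordinate B S (s + t) ω - subordinate B S s ω)
        inferInstance) P := by
  have hXm := measurable_subordinate hX hr
  refine indep_of_setIntegral_charFun ((hXm _).sub (hXm _)) ?_
  rw [iSup_comap_le_eq_comap]
  rintro _ ⟨Γ, hΓ, rfl⟩ ξ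
  exact setIntegral_exp_subordinate hX hr s t hΓ ξ

theorem charFun_subordinate_increment [IsProbabilityMeasure P] (hX : IsSubordination P B S f)
    (t : ℝ≥0) :
    charFun (P.map fun ω => subordinate B S t ω - subordinate B S 0 ω) =
      subordinateCharFun f t := by
  obtain ⟨B', S', hX', hr', -, hB, hS⟩ := hX.exists_regular 0 (fun _ => True) trivial
    (ae_of_all _ fun _ => trivial)
  rw [← (subordinate_increment hX' hr' 0 t).1, zero_add]
  congr 1
  refine Measure.map_congr ?_
  filter_upwards [hB, hS] with ω h1 h2
  simp only [subordinate, h1, h2]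

theorem aemeasurable_subordinate_increment (hX : IsSubordination P B S f) (t : ℝ≥0) :
    AEMeasurable (fun ω => subordinate B S t ω - subordinate B S 0 ω) P := by
  obtain ⟨B', S', hX', hr', -, hB, hS⟩ := hX.exists_regular 0 (fun _ => True) trivial
    (ae_of_all _ fun _ => trivial)
  have hm := measurable_subordinate hX' hr'
  refine ⟨_, (hm t).sub (hm 0), ?_⟩
  filter_upwards [hB, hS] with ω h1 h2
  simp only [subordinate, Pi.sub_apply, h1, h2]

theorem transitionFunction_eq_map_add [IsProbabilityMeasure P] {D : Ω → Eucl d}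
    (hX : IsSubordination P B S f)
    {t : ℝ≥0} (hD : Measurable D) (hφ : charFun (P.map D) = subordinateCharFun f t)
    (x : Eucl d) :
    transitionFunction P (subordinate B S) t x = P.map fun ω => x + D ω := by
  have h := aemeasurable_subordinate_increment hX t
  have hx : Measurable fun y : Eucl d => x + y := measurable_const.add measurable_id
  have heq : P.map (fun ω => subordinate B S t ω - subordinate B S 0 ω) = P.map D :=
    Measure.ext_of_charFun (by rw [hφ, charFun_subordinate_increment hX])
  have h1 := AEMeasurable.map_map_of_aemeasurable hx.aemeasurable h
  have h2 := Measure.map_map (μ := P) hx hD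
  rw [heq, h2] at h1
  exact h1.symm

/-- The transition function is determined by the Laplace exponent. -/
theorem transitionFunction_eq [IsProbabilityMeasure P] {Ω' : Type*} [MeasurableSpace Ω']
    {P' : Measure Ω'}
    [IsProbabilityMeasure P'] {B' : ℝ≥0 → Ω' → Eucl d} {S' : ℝ≥0 → Ω' → ℝ≥0}
    (hX : IsSubordination P B S f) (hX' : IsSubordination P' B' S' f) :
    transitionFunction P (subordinate B S) = transitionFunction P' (subordinate B' S') := by
  funext t x
  have h := aemeasurable_subordinate_increment hX t
  have h' := aemeasurable_subordinate_increment hX' t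
  have hx : Measurable fun y : Eucl d => x + y := measurable_const.add measurable_id
  have heq : P.map (fun ω => subordinate B S t ω - subordinate B S 0 ω) =
      P'.map (fun ω => subordinate B' S' t ω - subordinate B' S' 0 ω) :=
    Measure.ext_of_charFun (by
      rw [charFun_subordinate_increment hX', charFun_subordinate_increment hX])
  have h1 := AEMeasurable.map_map_of_aemeasurable hx.aemeasurable h
  have h2 := AEMeasurable.map_map_of_aemeasurable hx.aemeasurable h'
  rw [heq, h2] at h1
  exact h1.symm

theorem transitionFunction_eq_map (hr : RegularPaths B S)
    {x : Eucl d} (hx : ∀ ω, B 0 ω = x) (t : ℝ≥0) :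
    transitionFunction P (subordinate B S) t x = P.map (subordinate B S t) := by
  rw [transitionFunction]
  congr 1
  funext ω
  simp [subordinate, hr.start, hx]

theorem isMarkovProcess_subordinate [IsProbabilityMeasure P] (hX : IsSubordination P B S f)
    (hr : RegularPaths B S)
    {μ : Measure (Eucl d)} (hμ : P.map (B 0) = μ) :
    IsMarkovProcess P (subordinate B S) (transitionFunction P (subordinate B S)) μ where
  measurable := measurable_subordinate hX hr
  initial := by
    rw [← hμ]
    congr 1
    funext ω
    simp [subordinate, hr.start]
  right_continuous_paths := ae_of_all _ fun ω t =>
    (hr.continuous ω).continuousAt.comp_continuousWithinAt (hr.right_continuous ω t)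
  left_limits := ae_of_all _ fun ω t => by
    have h := (hr.monotone ω).tendsto_nhdsLT t
    exact ⟨_, ((hr.continuous ω).tendsto _).comp h⟩
  markov := fun s t A hA => by
    have hXm := measurable_subordinate hX hr
    have hle : (⨆ (r : ℝ≥0) (_ : r ≤ s),
        MeasurableSpace.comap (subordinate B S r) inferInstance) ≤ ‹MeasurableSpace Ω› :=
      iSup₂_le fun r _ => (hXm r).comap_le
    obtain ⟨h1, h2⟩ := subordinate_increment hX hr s t
    have hXs : Measurable[⨆ (r : ℝ≥0) (_ : r ≤ s),
        MeasurableSpace.comap (subordinate B S r) inferInstance] (subordinate B S s) :=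
      Measurable.of_comap_le (le_iSup₂_of_le s le_rfl le_rfl)
    have h3 := condExp_indicator_add hle hXs ((hXm (s + t)).sub (hXm s)) h2 hA
    have h4 : (fun ω => subordinate B S s ω + (subordinate B S (s + t) - subordinate B S s) ω) =
        subordinate B S (s + t) := by
      funext ω; simp
    rw [h4] at h3
    refine h3.trans (ae_of_all _ fun ω => ?_)
    have h5 := transitionFunction_eq_map_add hX ((hXm (s + t)).sub (hXm s)) h1
      (subordinate B S s ω)
    simp only [h5]

end Markov

/-! ### The mirror and the reflection. -/

section Geometry

variable {d : ℕ}

/-- The signed (unnormalized) distance to the mirror. -/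
def mirrorDist (x y z : Eucl d) : ℝ := inner ℝ (z - (2⁻¹ : ℝ) • (x + y)) (x - y)

/-- The linear part of the reflection in a hyperplane with normal vector `v`. -/
def linReflect (v z : Eucl d) : Eucl d := z - (2 * inner ℝ z v / ‖v‖ ^ 2) • v

theorem mem_mirror_iff {x y z : Eucl d} : z ∈ mirror x y ↔ mirrorDist x y z = 0 := Iff.rfl

theorem mirrorDist_self (x z : Eucl d) : mirrorDist x x z = 0 := by simp [mirrorDist]

theorem mirrorDist_left (x y : Eucl d) : mirrorDist x y x = ‖x - y‖ ^ 2 / 2 := by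
  have : x - (2⁻¹ : ℝ) • (x + y) = (2⁻¹ : ℝ) • (x - y) := by module
  rw [mirrorDist, this, real_inner_smul_left, real_inner_self_eq_norm_sq]
  ring

theorem mirrorDist_eq_add (x y z : Eucl d) :
    mirrorDist x y z = inner ℝ (z - x) (x - y) + ‖x - y‖ ^ 2 / 2 := by
  rw [← mirrorDist_left, mirrorDist, mirrorDist, ← inner_add_left]
  congr 1
  abel

theorem mirrorDist_eq_sub (x y z : Eucl d) :
    mirrorDist x y z = inner ℝ (z - y) (x - y) - ‖x - y‖ ^ 2 / 2 := by
  have h : z - x = z - y - (x - y) := by abel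
  rw [mirrorDist_eq_add, h, inner_sub_left, real_inner_self_eq_norm_sq]
  ring

theorem reflect_eq (x y z : Eucl d) :
    reflect x y z = z - (2 * mirrorDist x y z / ‖x - y‖ ^ 2) • (x - y) := rfl

theorem reflect_of_mirrorDist_eq_zero {x y z : Eucl d} (h : mirrorDist x y z = 0) :
    reflect x y z = z := by simp [reflect_eq, h]

theorem mirrorDist_eq_zero_of_reflect {x y z : Eucl d} (h : reflect x y z = z) :
    mirrorDist x y z = 0 := by
  rcases eq_or_ne x y with rfl | hxy
  · exact mirrorDist_self _ _
  have hn : ‖x - y‖ ≠ 0 := norm_ne_zero_iff.2 (sub_ne_zero.2 hxy)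
  rw [reflect_eq, sub_eq_self, smul_eq_zero] at h
  rcases h with h | h
  · field_simp at h
    linarith
  · exact absurd (sub_eq_zero.1 h) hxy

theorem mirrorDist_reflect (x y z : Eucl d) :
    mirrorDist x y (reflect x y z) = -mirrorDist x y z := by
  rcases eq_or_ne x y with rfl | hxy
  · simp [mirrorDist_self]
  have hn : ‖x - y‖ ≠ 0 := norm_ne_zero_iff.2 (sub_ne_zero.2 hxy)
  have h : reflect x y z - (2⁻¹ : ℝ) • (x + y) = (z - (2⁻¹ : ℝ) • (x + y)) -
      (2 * mirrorDist x y z / ‖x - y‖ ^ 2) • (x - y) := by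
    rw [reflect_eq]; abel
  rw [mirrorDist, h, inner_sub_left, real_inner_smul_left, real_inner_self_eq_norm_sq]
  change mirrorDist x y z - _ = _
  field_simp
  ring

theorem reflect_left (x y : Eucl d) : reflect x y x = y := by
  rcases eq_or_ne x y with rfl | hxy
  · exact reflect_of_mirrorDist_eq_zero (mirrorDist_self _ _)
  have hn : ‖x - y‖ ≠ 0 := norm_ne_zero_iff.2 (sub_ne_zero.2 hxy)
  rw [reflect_eq, mirrorDist_left]
  have : 2 * (‖x - y‖ ^ 2 / 2) / ‖x - y‖ ^ 2 = 1 := by field_simp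
  rw [this, one_smul]
  abel

theorem reflect_sub_reflect (x y z z' : Eucl d) :
    reflect x y z - reflect x y z' = linReflect (x - y) (z - z') := by
  have h : inner ℝ (z - z') (x - y) = mirrorDist x y z - mirrorDist x y z' := by
    rw [mirrorDist, mirrorDist, ← inner_sub_left]
    congr 1
    abel
  rw [reflect_eq, reflect_eq, linReflect, h, mul_sub, sub_div, sub_smul]
  abel

theorem linReflect_sub (v z z' : Eucl d) :
    linReflect v (z - z') = linReflect v z - linReflect v z' := by
  rw [linReflect, linReflect, linReflect, inner_sub_left, mul_sub, sub_div, sub_smul]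
  abel

/-- Self-adjointness moves the reflection from a Brownian increment to the frequency, where only the
norm matters. -/
theorem inner_linReflect (v z ξ : Eucl d) :
    inner ℝ (linReflect v z) ξ = (inner ℝ z (linReflect v ξ) : ℝ) := by
  rw [linReflect, linReflect, inner_sub_left, inner_sub_right, real_inner_smul_left,
    real_inner_smul_right, real_inner_comm ξ v]
  ring

theorem norm_linReflect (v ξ : Eucl d) : ‖linReflect v ξ‖ = ‖ξ‖ := by
  rcases eq_or_ne v 0 with rfl | hv
  · simp [linReflect]
  have hn : ‖v‖ ≠ 0 := norm_ne_zero_iff.2 hv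
  have h : ‖linReflect v ξ‖ ^ 2 = ‖ξ‖ ^ 2 := by
    rw [linReflect, norm_sub_sq_real, real_inner_smul_right, norm_smul, mul_pow, Real.norm_eq_abs,
      sq_abs]
    field_simp
    ring
  exact (sq_eq_sq₀ (norm_nonneg _) (norm_nonneg _)).1 h

theorem continuous_mirrorDist :
    Continuous fun p : Eucl d × Eucl d × Eucl d => mirrorDist p.1 p.2.1 p.2.2 := by
  unfold mirrorDist; fun_prop

theorem measurable_mirrorDist :
    Measurable fun p : Eucl d × Eucl d × Eucl d => mirrorDist p.1 p.2.1 p.2.2 :=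
  continuous_mirrorDist.measurable

theorem continuous_reflect (x y : Eucl d) : Continuous (reflect x y) := by
  unfold reflect; fun_prop

theorem continuous_linReflect (v : Eucl d) : Continuous (linReflect v) := by
  unfold linReflect; fun_prop

theorem measurable_linReflect :
    Measurable fun p : Eucl d × Eucl d => linReflect p.1 p.2 := by
  unfold linReflect; fun_prop

theorem measurable_reflect :
    Measurable fun p : Eucl d × Eucl d × Eucl d => reflect p.1 p.2.1 p.2.2 := by
  unfold reflect; fun_prop

end Geometry

/-! ### Hitting time and mirror process, path by path. -/

section MirrorPaths

variable {d : ℕ} {Ω : Type*} {x y : Eucl d} {B : ℝ≥0 → Ω → Eucl d} {ω : Ω}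

theorem mirrorTime_self (x : Eucl d) : mirrorTime x x B ω = 0 := by
  refine le_antisymm (ENNReal.le_of_forall_pos_le_add fun ε hε _ => ?_) zero_le
  rw [zero_add]
  exact iInf₂_le ε ⟨hε, mem_mirror_iff.2 (mirrorDist_self _ _)⟩

theorem continuous_mirrorDist_path (hB : Continuous fun t => B t ω) :
    Continuous fun t => mirrorDist x y (B t ω) :=
  continuous_mirrorDist.comp (continuous_const.prodMk (continuous_const.prodMk hB))

/-- For `x ≠ y` the path starts strictly on the positive side, so by the intermediate value theorem
it cannot leave that side without hitting the mirror. Conversely, positivity up to `s` persists a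
little beyond `s`, which makes the inequality strict. For `x = y` both sides are false. -/
theorem lt_mirrorTime_iff (hB : Continuous fun t => B t ω) (h0 : B 0 ω = x) (s : ℝ≥0) :
    (s : ℝ≥0∞) < mirrorTime x y B ω ↔ ∀ u ≤ s, 0 < mirrorDist x y (B u ω) := by
  have hb := continuous_mirrorDist_path (x := x) (y := y) hB
  constructor
  · intro hs u hu
    have hxy : x ≠ y := by
      rintro rfl
      rw [mirrorTime_self] at hs
      exact not_lt_zero hs
    have hn : 0 < ‖x - y‖ := norm_pos_iff.2 (sub_ne_zero.2 hxy)
    have hb0 : 0 < mirrorDist x y (B 0 ω) := by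
      rw [h0, mirrorDist_left]; positivity
    by_contra! hneg
    obtain ⟨r, ⟨-, hr⟩, hr0⟩ := intermediate_value_Icc' (zero_le (a := u)) hb.continuousOn
      (show (0 : ℝ) ∈ Icc _ _ from ⟨hneg, hb0.le⟩)
    have hrpos : 0 < r := by
      rcases eq_or_ne r 0 with rfl | h
      · exact absurd hr0 hb0.ne'
      · exact pos_iff_ne_zero.2 h
    have : mirrorTime x y B ω ≤ r := iInf₂_le r ⟨hrpos, mem_mirror_iff.2 hr0⟩
    exact absurd (hs.trans_le this) (not_lt.2 (by exact_mod_cast hr.trans hu))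
  · intro h
    have hev : ∀ᶠ u in 𝓝[>] s, 0 < mirrorDist x y (B u ω) :=
      (hb.tendsto s).mono_left nhdsWithin_le_nhds (lt_mem_nhds (h s le_rfl))
    obtain ⟨s', hs', hss⟩ := (mem_nhdsGT_iff_exists_Ioo_subset' (show s < s + 1 by simp)).1 hev
    refine lt_of_lt_of_le (show (s : ℝ≥0∞) < s' by exact_mod_cast hs') ?_
    refine le_iInf₂ fun u hu => ?_
    by_contra! hlt
    have hlt' : u < s' := by exact_mod_cast hlt
    have : 0 < mirrorDist x y (B u ω) := by
      rcases le_or_gt u s with hus | hus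
      · exact h u hus
      · exact hss ⟨hus, hlt'⟩
    exact this.ne' (mem_mirror_iff.1 hu.2)

/-- The infimum is attained: the path has a zero at some positive time no later than `t`, and no
such zero can precede `τ = t`. -/
theorem mirrorDist_mirrorTime (hB : Continuous fun t => B t ω) (h0 : B 0 ω = x) {t : ℝ≥0}
    (ht : mirrorTime x y B ω = t) : mirrorDist x y (B t ω) = 0 := by
  rcases eq_or_ne x y with rfl | hxy
  · exact mirrorDist_self _ _
  have hn : 0 < ‖x - y‖ := norm_pos_iff.2 (sub_ne_zero.2 hxy)
  have hb := continuous_mirrorDist_path (x := x) (y := y) hB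
  have hb0 : 0 < mirrorDist x y (B 0 ω) := by
    rw [h0, mirrorDist_left]; positivity
  have h1 : ¬ ((t : ℝ≥0∞) < mirrorTime x y B ω) := by rw [ht]; exact lt_irrefl _
  rw [lt_mirrorTime_iff hB h0] at h1
  push Not at h1
  obtain ⟨u, hut, hu⟩ := h1
  obtain ⟨r, ⟨-, hr⟩, hr0⟩ := intermediate_value_Icc' (zero_le (a := u)) hb.continuousOn
    (show (0 : ℝ) ∈ Icc _ _ from ⟨hu, hb0.le⟩)
  have hrpos : 0 < r := by
    rcases eq_or_ne r 0 with rfl | h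
    · exact absurd hr0 hb0.ne'
    · exact pos_iff_ne_zero.2 h
  have h2 : mirrorTime x y B ω ≤ r := iInf₂_le r ⟨hrpos, mem_mirror_iff.2 hr0⟩
  rw [ht] at h2
  have h3 : t = r := le_antisymm (by exact_mod_cast h2) (hr.trans hut)
  rw [h3]; exact hr0

theorem mirrorProcess_of_lt {t : ℝ≥0} (h : (t : ℝ≥0∞) < mirrorTime x y B ω) :
    mirrorProcess x y B t ω = reflect x y (B t ω) := if_pos h.le

theorem mirrorProcess_of_le (hB : Continuous fun t => B t ω) (h0 : B 0 ω = x) {t : ℝ≥0}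
    (h : mirrorTime x y B ω ≤ t) : mirrorProcess x y B t ω = B t ω := by
  rw [mirrorProcess]
  split_ifs with h1
  · exact reflect_of_mirrorDist_eq_zero (mirrorDist_mirrorTime hB h0 (le_antisymm h h1))
  · rfl

theorem mirrorProcess_zero (h0 : B 0 ω = x) :
    mirrorProcess x y B 0 ω = y := by
  rw [mirrorProcess, if_pos (by simp), h0, reflect_left]

/-- The two pieces agree at the switching time, because the path is then on the mirror and the
reflection fixes it. -/
theorem continuous_mirrorProcess (hB : Continuous fun t => B t ω) (h0 : B 0 ω = x) :
    Continuous fun t => mirrorProcess x y B t ω := by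
  classical
  have hR : Continuous fun t => reflect x y (B t ω) := (continuous_reflect x y).comp hB
  rcases eq_or_ne (mirrorTime x y B ω) ∞ with ht | ht
  · have : (fun t => mirrorProcess x y B t ω) = fun t => reflect x y (B t ω) := by
      funext t
      rw [mirrorProcess, ht, if_pos le_top]
    rw [this]; exact hR
  · lift mirrorTime x y B ω to ℝ≥0 using ht with T hT
    have : (fun t => mirrorProcess x y B t ω) =
        fun t => if t ≤ T then reflect x y (B t ω) else B t ω := by
      funext t
      rw [mirrorProcess, ← hT]
      simp only [ENNReal.coe_le_coe]
    rw [this]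
    refine Continuous.if_le hR hB continuous_id continuous_const ?_
    rintro t rfl
    exact reflect_of_mirrorDist_eq_zero (mirrorDist_mirrorTime hB h0 hT.symm)

/-- Telescoping with a change of summand at `K`; the minimum covers a change beyond the range. -/
theorem sum_range_ite_lt_sub {E : Type*} [AddCommGroup E] (a c : ℕ → E) (K n : ℕ) :
    ∑ j ∈ Finset.range n, (if j < K then a (j + 1) - a j else c (j + 1) - c j) =
      a (min n K) - a 0 + (c n - c (min n K)) := by
  induction n with
  | zero => simp
  | succ n ih =>
    rw [Finset.sum_range_succ, ih]
    split_ifs with h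
    · rw [min_eq_left h.le, min_eq_left h]; abel
    · rw [min_eq_right (by omega : K ≤ n), min_eq_right (by omega : K ≤ n + 1)]; abel

/-- The increment of the mirror process as a limit of Riemann sums. -/
theorem tendsto_sum_mirror (hB : Continuous fun t => B t ω) (h0 : B 0 ω = x) (s h : ℝ≥0)
    (hh : 0 < h) :
    Tendsto (fun N : ℕ => ∑ k ∈ Finset.range (N + 1),
      (if ((s + k * (h / (N + 1)) : ℝ≥0) : ℝ≥0∞) < mirrorTime x y B ω then
        linReflect (x - y) (B (s + (k + 1 : ℕ) * (h / (N + 1))) ω - B (s + k * (h / (N + 1))) ω)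
      else B (s + (k + 1 : ℕ) * (h / (N + 1))) ω - B (s + k * (h / (N + 1))) ω)) atTop
      (𝓝 (mirrorProcess x y B (s + h) ω - mirrorProcess x y B s ω)) := by
  classical
  have hend : ∀ N : ℕ, s + ((N + 1 : ℕ) : ℝ≥0) * (h / (N + 1)) = s + h := by
    intro N
    congr 1
    push_cast
    field_simp
  rcases lt_or_ge ((s + h : ℝ≥0) : ℝ≥0∞) (mirrorTime x y B ω) with hlt | hge
  · have hs : ((s : ℝ≥0) : ℝ≥0∞) < mirrorTime x y B ω :=
      lt_of_le_of_lt (by exact_mod_cast le_self_add) hlt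
    refine tendsto_const_nhds.congr fun N => ?_
    rw [mirrorProcess_of_lt hlt, mirrorProcess_of_lt hs, reflect_sub_reflect, linReflect_sub]
    have := Finset.sum_range_sub (fun k : ℕ => linReflect (x - y) (B (s + k * (h / (N + 1))) ω))
      (N + 1)
    rw [hend] at this
    simp only [Nat.cast_zero, zero_mul, add_zero] at this
    rw [← this]
    refine Finset.sum_congr rfl fun k hk => ?_
    rw [if_pos, linReflect_sub]
    refine lt_of_le_of_lt ?_ hlt
    rw [← hend N, ENNReal.coe_le_coe]
    gcongr
    exact (Finset.mem_range.1 hk).le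
  obtain ⟨T, hT⟩ : ∃ T : ℝ≥0, (T : ℝ≥0∞) = mirrorTime x y B ω :=
    ⟨_, ENNReal.coe_toNNReal (ne_top_of_le_ne_top ENNReal.coe_ne_top hge)⟩
  rw [← hT, ENNReal.coe_le_coe] at hge
  have hTs : ∀ u : ℝ≥0, (u : ℝ≥0∞) < mirrorTime x y B ω ↔ u < T := fun u => by
    rw [← hT, ENNReal.coe_lt_coe]
  set ρ := max s T with hρ
  let δ : ℕ → ℝ≥0 := fun N => h / (N + 1)
  have hδ : ∀ N, 0 < δ N := fun N => by positivity
  -- The number of grid points before `T`, zero if `T ≤ s`. The sum switches at the grid point `v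
  -- N`, which lies within one mesh of `max s T`.
  let K : ℕ → ℕ := fun N => ⌈((T : ℝ) - s) / δ N⌉₊
  let v : ℕ → ℝ≥0 := fun N => s + ((min (N + 1) (K N) : ℕ) : ℝ≥0) * δ N
  have hK : ∀ N k : ℕ, s + k * δ N < T ↔ k < K N := by
    intro N k
    have : (0 : ℝ) < δ N := hδ N
    rw [Nat.lt_ceil, lt_div_iff₀ this, ← NNReal.coe_lt_coe]
    push_cast
    constructor <;> intro h' <;> linarith
  have hδ0 : Tendsto δ atTop (𝓝 0) := by
    have h1 : Tendsto (fun N : ℕ => ((δ N : ℝ≥0) : ℝ)) atTop (𝓝 0) := by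
      have := (tendsto_one_div_add_atTop_nhds_zero_nat (𝕜 := ℝ)).const_mul (h : ℝ)
      rw [mul_zero] at this
      refine this.congr fun N => ?_
      simp only [δ]
      push_cast
      ring
    exact NNReal.tendsto_coe.1 (by simpa using h1)
  have hv : Tendsto v atTop (𝓝 ρ) := by
    have hup : Tendsto (fun N => ρ + δ N) atTop (𝓝 ρ) := by
      simpa using hδ0.const_add ρ
    refine tendsto_of_tendsto_of_tendsto_of_le_of_le tendsto_const_nhds hup ?_ ?_
    · intro N
      refine max_le le_self_add ?_
      rcases le_total (N + 1) (K N) with hle | hle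
      · simp only [v, min_eq_left hle, δ]
        rw [hend]; exact hge
      · simp only [v, min_eq_right hle]
        exact not_lt.1 fun h' => lt_irrefl _ ((hK N (K N)).1 h')
    · intro N
      rcases Nat.eq_zero_or_pos (K N) with hz | hpos
      · simp only [v, hz, Nat.min_zero, Nat.cast_zero, zero_mul, add_zero]
        exact (le_max_left _ _).trans le_self_add
      · obtain ⟨k, hk⟩ := Nat.exists_eq_succ_of_ne_zero hpos.ne'
        have h1 : s + k * δ N < T := (hK N k).2 (by omega)
        have h2 : v N ≤ s + ((k + 1 : ℕ) : ℝ≥0) * δ N := by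
          simp only [v]
          gcongr
          omega
        refine h2.trans ?_
        rw [Nat.cast_add, Nat.cast_one, add_mul, one_mul, ← add_assoc]
        exact add_le_add (h1.le.trans (le_max_right _ _)) le_rfl
  have hBv : Tendsto (fun N => B (v N) ω) atTop (𝓝 (B ρ ω)) := (hB.tendsto ρ).comp hv
  have hABv : Tendsto (fun N => linReflect (x - y) (B (v N) ω)) atTop
      (𝓝 (linReflect (x - y) (B ρ ω))) := ((continuous_linReflect _).tendsto _).comp hBv
  have hlim := (hABv.sub_const (linReflect (x - y) (B s ω))).add (hBv.const_sub (B (s + h) ω))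
  have hval : mirrorProcess x y B (s + h) ω - mirrorProcess x y B s ω =
      linReflect (x - y) (B ρ ω) - linReflect (x - y) (B s ω) + (B (s + h) ω - B ρ ω) := by
    rw [mirrorProcess_of_le (t := s + h) hB h0 (by rw [← hT]; exact_mod_cast hge)]
    rcases lt_or_ge s T with hsT | hsT
    · rw [mirrorProcess_of_lt ((hTs s).2 hsT), hρ, max_eq_right hsT.le, ← linReflect_sub,
        ← reflect_sub_reflect,
        reflect_of_mirrorDist_eq_zero (mirrorDist_mirrorTime hB h0 hT.symm)]
      abel
    · rw [mirrorProcess_of_le hB h0 (by rw [← hT]; exact_mod_cast hsT), hρ, max_eq_left hsT]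
      abel
  rw [hval]
  refine hlim.congr fun N => ?_
  have hsum := sum_range_ite_lt_sub (fun k : ℕ => linReflect (x - y) (B (s + k * δ N) ω))
    (fun k : ℕ => B (s + k * δ N) ω) (K N) (N + 1)
  simp only [Nat.cast_zero, zero_mul, add_zero] at hsum
  have hend' : s + ((N + 1 : ℕ) : ℝ≥0) * δ N = s + h := hend N
  rw [hend'] at hsum
  refine hsum.symm.trans (Finset.sum_congr rfl fun k _ => ?_)
  simp only [hTs, ← hK N k, linReflect_sub]
  rfl

end MirrorPaths

/-! ### Brownian motion for a filtration; the mirror process is one. -/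

section FilteredBM

variable {d : ℕ} {Ω : Type*} [m0 : MeasurableSpace Ω] {P : Measure Ω}
  {B : ℝ≥0 → Ω → Eucl d} {ℱ : Filtration ℝ≥0 m0} {X Y : Ω → Eucl d}

/-- Brownian motion with respect to a filtration, with all paths continuous: the increments have
the right characteristic function, also when restricted to an event of the past. -/
structure IsFilteredBM (P : Measure Ω) (ℱ : Filtration ℝ≥0 m0) (B : ℝ≥0 → Ω → Eucl d) : Prop where
  adapted : ∀ t, Measurable[ℱ t] (B t)
  continuous : ∀ ω, Continuous fun t => B t ω
  setIntegral_exp : ∀ (s h : ℝ≥0) (G : Set Ω), MeasurableSet[ℱ s] G → ∀ ξ : Eucl d,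
    ∫ ω in G, Complex.exp (inner ℝ (B (s + h) ω - B s ω) ξ * Complex.I) ∂P =
      P.real G * Complex.exp (-((h : ℝ) * ‖ξ‖ ^ 2 : ℝ))

theorem IsFilteredBM.measurable (hB : IsFilteredBM P ℱ B) (t : ℝ≥0) : Measurable (B t) :=
  (hB.adapted t).mono (ℱ.le t) le_rfl

theorem IsFilteredBM.increment [IsProbabilityMeasure P] (hB : IsFilteredBM P ℱ B) (s h : ℝ≥0) :
    (charFun (P.map fun ω => B (s + h) ω - B s ω) =
      fun ξ => Complex.exp (-((h : ℝ) * ‖ξ‖ ^ 2 : ℝ))) ∧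
    Indep (ℱ s) (MeasurableSpace.comap (fun ω => B (s + h) ω - B s ω) inferInstance) P :=
  indep_of_setIntegral_charFun ((hB.measurable _).sub (hB.measurable _)) (hB.setIntegral_exp s h)

theorem IsFilteredBM.isBrownianMotion [IsProbabilityMeasure P] (hB : IsFilteredBM P ℱ B) :
    IsBrownianMotion P B where
  measurable := hB.measurable
  continuous_paths := ae_of_all _ hB.continuous
  indep_increments := fun s h => by
    rw [IndepFun_iff_Indep]
    have hm : Measurable[ℱ s] fun ω (r : Iic s) => B r ω :=
      @measurable_pi_lambda _ _ _ (ℱ s) _ _ fun r => (hB.adapted r).mono (ℱ.mono r.2) le_rfl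
    exact (indep_of_indep_of_le_left (hB.increment s h).2 hm.comap_le).symm
  charFun_increments := fun s h ξ => by rw [(hB.increment s h).1]

/-- A countable description of the event, for measurability: a positive continuous function on `[0,
s]` is bounded below, and a lower bound needs checking only at dense times. Cutting these times at
`s` keeps the description within the past of `s`. -/
theorem lt_mirrorTime_iff_exists {Ω : Type*} {B : ℝ≥0 → Ω → Eucl d} {x y : Eucl d} {ω : Ω}
    (hB : Continuous fun t => B t ω)
    (h0 : B 0 ω = x) (s : ℝ≥0) :
    (s : ℝ≥0∞) < mirrorTime x y B ω ↔ ∃ n : ℕ, ∀ k : ℕ, 1 / ((n : ℝ) + 1) ≤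
      mirrorDist x y (B (min (TopologicalSpace.denseSeq ℝ≥0 k) s) ω) := by
  have hb := continuous_mirrorDist_path (x := x) (y := y) hB
  rw [lt_mirrorTime_iff hB h0]
  constructor
  · intro h
    obtain ⟨u, hu, hmin⟩ := (isCompact_Icc (a := (0 : ℝ≥0)) (b := s)).exists_isMinOn
      ⟨0, by simp⟩ hb.continuousOn
    obtain ⟨n, hn⟩ := exists_nat_one_div_lt (h u hu.2)
    exact ⟨n, fun k => hn.le.trans (hmin ⟨zero_le, min_le_right _ _⟩)⟩
  · rintro ⟨n, hn⟩ u hu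
    have hclosed : IsClosed {u : ℝ≥0 | 1 / ((n : ℝ) + 1) ≤ mirrorDist x y (B (min u s) ω)} :=
      isClosed_le continuous_const (hb.comp (continuous_id.min continuous_const))
    have hdense : closure (range (TopologicalSpace.denseSeq ℝ≥0)) ⊆
        {u : ℝ≥0 | 1 / ((n : ℝ) + 1) ≤ mirrorDist x y (B (min u s) ω)} :=
      hclosed.closure_subset_iff.2 (range_subset_iff.2 hn)
    rw [(TopologicalSpace.denseRange_denseSeq ℝ≥0).closure_range] at hdense
    have : 1 / ((n : ℝ) + 1) ≤ mirrorDist x y (B (min u s) ω) := hdense (mem_univ u)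
    rw [min_eq_left hu] at this
    exact lt_of_lt_of_le (by positivity) this

theorem measurableSet_lt_mirrorTime {Ω : Type*} {m : MeasurableSpace Ω} {B : ℝ≥0 → Ω → Eucl d}
    {X Y : Ω → Eucl d} {s : ℝ≥0}
    (hB : ∀ ω, Continuous fun t => B t ω) (h0 : ∀ ω, B 0 ω = X ω)
    (hBm : ∀ u ≤ s, Measurable[m] (B u)) (hX : Measurable[m] X) (hY : Measurable[m] Y) :
    MeasurableSet[m] {ω | (s : ℝ≥0∞) < mirrorTime (X ω) (Y ω) B ω} := by
  have hset : {ω | (s : ℝ≥0∞) < mirrorTime (X ω) (Y ω) B ω} = ⋃ n : ℕ, ⋂ k : ℕ,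
      {ω | 1 / ((n : ℝ) + 1) ≤
        mirrorDist (X ω) (Y ω) (B (min (TopologicalSpace.denseSeq ℝ≥0 k) s) ω)} := by
    ext ω
    simp only [mem_ofPred_eq, mem_iUnion, mem_iInter]
    exact lt_mirrorTime_iff_exists (hB ω) (h0 ω) s
  rw [hset]
  refine MeasurableSet.iUnion fun n => MeasurableSet.iInter fun k => ?_
  have h1 : Measurable[m] fun ω => (X ω, Y ω, B (min (TopologicalSpace.denseSeq ℝ≥0 k) s) ω) :=
    hX.prodMk (hY.prodMk (hBm _ (min_le_right _ _)))
  have h2 := measurable_mirrorDist.comp h1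
  have h3 : MeasurableSet (Ici (1 / ((n : ℝ) + 1))) := measurableSet_Ici
  convert h2 h3
  ext ω
  simp only [mem_preimage, mem_Ici, mem_ofPred_eq, Function.comp_apply]

theorem setIntegral_eq_integral_indicator_mul {G : Set Ω} (hG : MeasurableSet G) (F : Ω → ℂ) :
    ∫ ω in G, F ω ∂P = ∫ ω, G.indicator (fun _ => (1 : ℂ)) ω * F ω ∂P := by
  rw [← integral_indicator hG]
  refine integral_congr_ae (ae_of_all _ fun ω => ?_)
  by_cases h : ω ∈ G <;> simp [h]

/-- Characteristic function of a Riemann sum for the mirror process. -/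
theorem setIntegral_exp_sum_mirror [IsProbabilityMeasure P] (hB : IsFilteredBM P ℱ B)
    (h0 : ∀ ω, B 0 ω = X ω) (hY : Measurable[ℱ 0] Y) (s δ : ℝ≥0) {G : Set Ω}
    (hG : MeasurableSet[ℱ s] G) (ξ : Eucl d) (n : ℕ) :
    (Measurable[ℱ (s + n * δ)] fun ω => ∑ k ∈ Finset.range n,
      (if ((s + k * δ : ℝ≥0) : ℝ≥0∞) < mirrorTime (X ω) (Y ω) B ω then
        linReflect (X ω - Y ω) (B (s + (k + 1 : ℕ) * δ) ω - B (s + k * δ) ω)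
      else B (s + (k + 1 : ℕ) * δ) ω - B (s + k * δ) ω)) ∧
    ∫ ω in G, Complex.exp (inner ℝ (∑ k ∈ Finset.range n,
      (if ((s + k * δ : ℝ≥0) : ℝ≥0∞) < mirrorTime (X ω) (Y ω) B ω then
        linReflect (X ω - Y ω) (B (s + (k + 1 : ℕ) * δ) ω - B (s + k * δ) ω)
      else B (s + (k + 1 : ℕ) * δ) ω - B (s + k * δ) ω)) ξ * Complex.I) ∂P =
      P.real G * Complex.exp (-(((n * δ : ℝ≥0) : ℝ) * ‖ξ‖ ^ 2 : ℝ)) := by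
  classical
  have hX : Measurable[ℱ 0] X := by
    have := hB.adapted 0
    rwa [show B 0 = X from funext h0] at this
  induction n with
  | zero => simp
  | succ n ih =>
    obtain ⟨ihm, ihi⟩ := ih
    set Dn : Ω → Eucl d := fun ω => ∑ k ∈ Finset.range n,
      (if ((s + k * δ : ℝ≥0) : ℝ≥0∞) < mirrorTime (X ω) (Y ω) B ω then
        linReflect (X ω - Y ω) (B (s + (k + 1 : ℕ) * δ) ω - B (s + k * δ) ω)
      else B (s + (k + 1 : ℕ) * δ) ω - B (s + k * δ) ω) with hDn
    set t : ℝ≥0 := s + n * δ with ht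
    have ht' : s + (n + 1 : ℕ) * δ = t + δ := by
      rw [ht]; push_cast; ring
    have hst : s ≤ t := le_self_add
    have hev : MeasurableSet[ℱ t] {ω | (t : ℝ≥0∞) < mirrorTime (X ω) (Y ω) B ω} :=
      measurableSet_lt_mirrorTime hB.continuous h0
        (fun u hu => (hB.adapted u).mono (ℱ.mono hu) le_rfl)
        (hX.mono (ℱ.mono zero_le) le_rfl) (hY.mono (ℱ.mono zero_le) le_rfl)
    have hv : Measurable[ℱ t] fun ω => X ω - Y ω :=
      (hX.mono (ℱ.mono zero_le) le_rfl).sub (hY.mono (ℱ.mono zero_le) le_rfl)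
    simp only [Finset.sum_range_succ]
    rw [ht']
    constructor
    · have hmt : ℱ t ≤ ℱ (t + δ) := ℱ.mono le_self_add
      have hD : Measurable[ℱ (t + δ)] fun ω => B (t + δ) ω - B t ω :=
        (hB.adapted _).sub ((hB.adapted t).mono hmt le_rfl)
      refine (ihm.mono hmt le_rfl).add ?_
      refine Measurable.ite (hmt _ hev) ?_ hD
      exact measurable_linReflect.comp ((hv.mono hmt le_rfl).prodMk hD)
    · have hGt : MeasurableSet[ℱ t] G := ℱ.mono hst _ hG
      have hG0 : MeasurableSet G := ℱ.le s _ hG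
      -- The last term of the sum paired with `ξ` is the plain increment paired with `V`. This
      -- random frequency is known at time `t` and has norm `‖ξ‖`, so the conditional characteristic
      -- function is deterministic.
      let V : Ω → Eucl d := fun ω => if (t : ℝ≥0∞) < mirrorTime (X ω) (Y ω) B ω then
        linReflect (X ω - Y ω) ξ else ξ
      have hV : Measurable[ℱ t] V :=
        Measurable.ite hev (measurable_linReflect.comp (hv.prodMk measurable_const))
          measurable_const
      have hVn : ∀ ω, ‖V ω‖ = ‖ξ‖ := fun ω => by
        simp only [V]
        split_ifs
        · exact norm_linReflect _ _
        · rfl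
      let Z : Ω → ℂ := fun ω => G.indicator (fun _ => (1 : ℂ)) ω *
        Complex.exp (inner ℝ (Dn ω) ξ * Complex.I)
      have hexpm : Measurable fun x : Eucl d => Complex.exp (inner ℝ x ξ * Complex.I) := by
        have : Continuous fun x : Eucl d => Complex.exp (inner ℝ x ξ * Complex.I) := by fun_prop
        exact this.measurable
      have hZ : Measurable[ℱ t] Z := (measurable_const.indicator hGt).mul (hexpm.comp ihm)
      have hZ1 : ∀ ω, ‖Z ω‖ ≤ 1 := fun ω => by
        simp only [Z]
        rw [norm_mul, norm_exp_inner_mul_I, mul_one]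
        by_cases h : ω ∈ G <;> simp [h]
      obtain ⟨hφ, hind⟩ := hB.increment t δ
      have key := integral_mul_exp_of_indep (ℱ.le t) ((hB.measurable (t + δ)).sub (hB.measurable t))
        hind hZ hV hZ1
      have hcf : ∀ ω, charFun (P.map (B (t + δ) - B t)) (V ω) =
          Complex.exp (-((δ : ℝ) * ‖ξ‖ ^ 2 : ℝ)) := fun ω => by
        have := congrFun hφ (V ω)
        rw [hVn] at this
        exact this
      simp only [hcf] at key
      rw [integral_mul_const] at key
      simp only [Z] at key
      rw [← setIntegral_eq_integral_indicator_mul hG0, ihi] at key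
      rw [setIntegral_eq_integral_indicator_mul hG0]
      refine Eq.trans (integral_congr_ae (ae_of_all _ fun ω => ?_)) (key.trans ?_)
      · have hin : inner ℝ (if (t : ℝ≥0∞) < mirrorTime (X ω) (Y ω) B ω then
            linReflect (X ω - Y ω) (B (t + δ) ω - B t ω) else B (t + δ) ω - B t ω) ξ =
            (inner ℝ (B (t + δ) ω - B t ω) (V ω) : ℝ) := by
          simp only [V]
          split_ifs
          · exact inner_linReflect _ _ _
          · rfl
        change _ * Complex.exp ((inner ℝ (Dn ω + _) ξ : ℝ) * Complex.I) = _
        rw [inner_add_left, hin, mul_assoc, ← Complex.exp_add, Pi.sub_apply]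
        congr 2
        push_cast
        ring
      · rw [mul_assoc, ← Complex.exp_add]
        congr 2
        push_cast
        ring

/-- The mirror process of a Brownian motion is a Brownian motion for the same filtration. -/
theorem IsFilteredBM.mirror [IsProbabilityMeasure P] (hB : IsFilteredBM P ℱ B)
    (h0 : ∀ ω, B 0 ω = X ω) (hY : Measurable[ℱ 0] Y) :
    IsFilteredBM P ℱ fun t ω => mirrorProcess (X ω) (Y ω) B t ω where
  adapted := fun t => by
    have hX : Measurable[ℱ 0] X := by
      have := hB.adapted 0
      rwa [show B 0 = X from funext h0] at this
    have hXt : Measurable[ℱ t] X := hX.mono (ℱ.mono zero_le) le_rfl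
    have hYt : Measurable[ℱ t] Y := hY.mono (ℱ.mono zero_le) le_rfl
    classical
    have heq : (fun ω => mirrorProcess (X ω) (Y ω) B t ω) = fun ω =>
        if (t : ℝ≥0∞) < mirrorTime (X ω) (Y ω) B ω then reflect (X ω) (Y ω) (B t ω) else B t ω := by
      funext ω
      split_ifs with h
      · exact mirrorProcess_of_lt h
      · exact mirrorProcess_of_le (hB.continuous ω) (h0 ω) (not_lt.1 h)
    rw [heq]
    refine Measurable.ite ?_ ?_ (hB.adapted t)
    · exact measurableSet_lt_mirrorTime hB.continuous h0
        (fun u hu => (hB.adapted u).mono (ℱ.mono hu) le_rfl) hXt hYt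
    · exact measurable_reflect.comp (hXt.prodMk (hYt.prodMk (hB.adapted t)))
  continuous := fun ω => continuous_mirrorProcess (hB.continuous ω) (h0 ω)
  setIntegral_exp := fun s h G hG ξ => by
    rcases eq_or_ne h 0 with rfl | hh
    · simp
    have hcont : Continuous fun x : Eucl d => Complex.exp (inner ℝ x ξ * Complex.I) := by fun_prop
    have hsum := fun N : ℕ =>
      setIntegral_exp_sum_mirror hB h0 hY s (h / (N + 1)) hG ξ (N + 1)
    have hδ : ∀ N : ℕ, ((N + 1 : ℕ) : ℝ≥0) * (h / (N + 1)) = h := by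
      intro N
      push_cast
      field_simp
    have hlim := tendsto_integral_of_dominated_convergence (μ := P.restrict G) (fun _ => (1 : ℝ))
      (F := fun (N : ℕ) ω => Complex.exp (inner ℝ (∑ k ∈ Finset.range (N + 1),
        (if ((s + k * (h / (N + 1)) : ℝ≥0) : ℝ≥0∞) < mirrorTime (X ω) (Y ω) B ω then
          linReflect (X ω - Y ω)
            (B (s + (k + 1 : ℕ) * (h / (N + 1))) ω - B (s + k * (h / (N + 1))) ω)
        else B (s + (k + 1 : ℕ) * (h / (N + 1))) ω - B (s + k * (h / (N + 1))) ω)) ξ * Complex.I))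
      (f := fun ω => Complex.exp (inner ℝ (mirrorProcess (X ω) (Y ω) B (s + h) ω -
        mirrorProcess (X ω) (Y ω) B s ω) ξ * Complex.I))
      (fun N => (hcont.measurable.comp
        ((hsum N).1.mono (ℱ.le _) le_rfl)).aestronglyMeasurable) (integrable_const _)
      (fun N => ae_of_all _ fun ω => (norm_exp_inner_mul_I _ _).le)
      (ae_of_all _ fun ω => (hcont.tendsto _).comp
        (tendsto_sum_mirror (hB.continuous ω) (h0 ω) s h (pos_iff_ne_zero.2 hh)))
    refine tendsto_nhds_unique hlim (tendsto_const_nhds.congr fun N => ?_)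
    rw [(hsum N).2, hδ]

end FilteredBM

/-! ### Reflection principle and the tail of the hitting time. -/

section ReflectionPrinciple

variable {d : ℕ} {Ω : Type*} [m0 : MeasurableSpace Ω] {P : Measure Ω} [IsProbabilityMeasure P]
  {B : ℝ≥0 → Ω → Eucl d} {ℱ : Filtration ℝ≥0 m0}

theorem IsFilteredBM.map_inner (hB : IsFilteredBM P ℱ B) {x : Eucl d} (h0 : ∀ ω, B 0 ω = x)
    (s : ℝ≥0) (v : Eucl d) :
    P.map (fun ω => (inner ℝ (B s ω - x) v : ℝ)) = gaussianReal 0 (2 * s * ‖v‖₊ ^ 2) := by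
  have hm : Measurable fun ω => B s ω - x := (hB.measurable s).sub measurable_const
  have hi : Measurable fun z : Eucl d => (inner ℝ z v : ℝ) := by fun_prop
  have him : Measurable fun ω => (inner ℝ (B s ω - x) v : ℝ) := hi.comp hm
  have hprob := Measure.isProbabilityMeasure_map (μ := P) him.aemeasurable
  have hinc := (hB.increment 0 s).1
  simp only [h0, zero_add] at hinc
  apply Measure.ext_of_charFun (E := ℝ)
  ext t
  have h1 : charFun (P.map fun ω => (inner ℝ (B s ω - x) v : ℝ)) t =
      charFun (P.map fun ω => B s ω - x) (t • v) := by
    rw [charFun_apply, charFun_apply, integral_map him.aemeasurable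
      (by fun_prop : Measurable fun z : ℝ => _).aestronglyMeasurable,
      integral_map hm.aemeasurable
          (by fun_prop : Measurable fun z : Eucl d => _).aestronglyMeasurable]
    refine integral_congr_ae (ae_of_all _ fun ω => ?_)
    simp [real_inner_smul_right, mul_comm]
  rw [h1, hinc, charFun_gaussianReal]
  beta_reduce
  rw [norm_smul]
  congr 1
  push_cast
  rw [mul_pow, ← Complex.ofReal_pow ‖t‖ 2, Real.norm_eq_abs, sq_abs]
  push_cast
  ring

theorem gaussianReal_Ioc_le (v : ℝ≥0) (hv : v ≠ 0) (a b : ℝ) :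
    gaussianReal 0 v (Ioc a b) ≤ ENNReal.ofReal ((b - a) / √(2 * Real.pi * v)) := by
  rw [gaussianReal_apply _ hv]
  calc ∫⁻ x in Ioc a b, gaussianPDF 0 v x
      ≤ ∫⁻ _ in Ioc a b, ENNReal.ofReal (√(2 * Real.pi * v))⁻¹ := by
        refine lintegral_mono fun x => ENNReal.ofReal_le_ofReal ?_
        rw [gaussianPDFReal]
        refine mul_le_of_le_one_right (by positivity) (Real.exp_le_one_iff.2 ?_)
        rw [neg_div, neg_nonpos]
        positivity
    _ = ENNReal.ofReal ((b - a) / √(2 * Real.pi * v)) := by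
        rw [lintegral_const, Measure.restrict_apply_univ, Real.volume_Ioc, mul_comm,
          div_eq_mul_inv, ENNReal.ofReal_mul' (by positivity)]

/-- Reflection principle: the law of the hitting time of the mirror. -/
theorem IsFilteredBM.measure_lt_mirrorTime_le (hB : IsFilteredBM P ℱ B) {x : Eucl d}
    (h0 : ∀ ω, B 0 ω = x) (y : Eucl d) {s : ℝ≥0} (hs : s ≠ 0) :
    P {ω | (s : ℝ≥0∞) < mirrorTime x y B ω} ≤
      ENNReal.ofReal (‖x - y‖ / (2 * √(Real.pi * s))) := by
  rcases eq_or_ne x y with rfl | hxy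
  · simp [mirrorTime_self]
  have hv : x - y ≠ 0 := sub_ne_zero.2 hxy
  have hn : 0 < ‖x - y‖ := norm_pos_iff.2 hv
  have hW := hB.mirror (X := fun _ => x) (Y := fun _ => y) h0 measurable_const
  have hW0 : ∀ ω, mirrorProcess x y B 0 ω = y := fun ω => mirrorProcess_zero (h0 ω)
  set γ := gaussianReal 0 (2 * s * ‖x - y‖₊ ^ 2) with hγ
  set a : ℝ := ‖x - y‖ ^ 2 / 2 with ha
  have hi : Measurable fun z : Eucl d => (inner ℝ z (x - y) : ℝ) := by fun_prop
  have hBm : Measurable fun ω => (inner ℝ (B s ω - x) (x - y) : ℝ) :=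
    hi.comp ((hB.measurable s).sub measurable_const)
  have hWm : Measurable fun ω => (inner ℝ (mirrorProcess x y B s ω - y) (x - y) : ℝ) :=
    hi.comp ((hW.measurable s).sub measurable_const)
  have h1 : P {ω | 0 < mirrorDist x y (B s ω)} = γ (Ioi (-a)) := by
    rw [hγ, ← hB.map_inner h0 s (x - y), Measure.map_apply hBm measurableSet_Ioi]
    congr 1
    ext ω
    simp only [mem_ofPred_eq, mem_preimage, mem_Ioi, mirrorDist_eq_add, ha]
    constructor <;> intro h <;> linarith
  have hset2 : {ω | 0 < mirrorDist x y (mirrorProcess x y B s ω)} =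
      (fun ω => (inner ℝ (mirrorProcess x y B s ω - y) (x - y) : ℝ)) ⁻¹' Ioi a := by
    ext ω
    simp only [mem_ofPred_eq, mem_preimage, mem_Ioi, mirrorDist_eq_sub, ha]
    constructor <;> intro h <;> linarith
  have h2 : P {ω | 0 < mirrorDist x y (mirrorProcess x y B s ω)} = γ (Ioi a) := by
    rw [hset2, hγ, ← hW.map_inner hW0 s (x - y), Measure.map_apply hWm measurableSet_Ioi]
  -- After `τ` the two processes coincide; before `τ` they are on opposite sides of the mirror, so
  -- the union is disjoint.
  have h3 : {ω | 0 < mirrorDist x y (B s ω)} = {ω | (s : ℝ≥0∞) < mirrorTime x y B ω} ∪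
      {ω | 0 < mirrorDist x y (mirrorProcess x y B s ω)} := by
    ext ω
    simp only [mem_ofPred_eq, mem_union]
    rcases lt_or_ge (s : ℝ≥0∞) (mirrorTime x y B ω) with h | h
    · simp only [h, true_or, iff_true]
      exact (lt_mirrorTime_iff (hB.continuous ω) (h0 ω) s).1 h s le_rfl
    · simp only [not_lt.2 h, false_or, mirrorProcess_of_le (hB.continuous ω) (h0 ω) h]
  have h4 : Disjoint {ω | (s : ℝ≥0∞) < mirrorTime x y B ω}
      {ω | 0 < mirrorDist x y (mirrorProcess x y B s ω)} := by
    rw [Set.disjoint_left]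
    intro ω h h'
    simp only [mem_ofPred_eq] at h h'
    rw [mirrorProcess_of_lt h, mirrorDist_reflect] at h'
    have := (lt_mirrorTime_iff (hB.continuous ω) (h0 ω) s).1 h s le_rfl
    linarith
  -- Subtracting the two Gaussian tails leaves an interval of length `‖x - y‖ ^ 2`, under a density
  -- of variance `2 s ‖x - y‖ ^ 2`.
  have h5 : γ (Ioi (-a)) = γ (Ioc (-a) a) + γ (Ioi a) := by
    rw [← measure_union (Ioc_disjoint_Ioi le_rfl) measurableSet_Ioi, Ioc_union_Ioi_eq_Ioi]
    have : 0 ≤ a := by positivity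
    linarith
  rw [h3, measure_union h4 (by rw [hset2]; exact hWm measurableSet_Ioi), h2, h5,
    ENNReal.add_left_inj (measure_ne_top _ _)] at h1
  rw [h1]
  have hs' : (0 : ℝ) < s := NNReal.coe_pos.2 (pos_iff_ne_zero.2 hs)
  refine (gaussianReal_Ioc_le _ ?_ _ _).trans (ENNReal.ofReal_le_ofReal (le_of_eq ?_))
  · have : ‖x - y‖₊ ≠ 0 := nnnorm_ne_zero_iff.2 hv
    positivity
  · push_cast
    have h6 : 2 * Real.pi * (2 * (s : ℝ) * ‖x - y‖ ^ 2) = (2 * ‖x - y‖) ^ 2 * (Real.pi * s) := by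
      ring
    rw [h6, Real.sqrt_mul (by positivity), Real.sqrt_sq (by positivity), ha]
    have : 0 < √(Real.pi * s) := by positivity
    field_simp
    ring

theorem lintegral_inv_sqrt_mul_exp_zero :
    ∫⁻ r in Ioi (0 : ℝ), ENNReal.ofReal (1 / √r) = ∞ := by
  by_contra h
  refine not_integrableOn_Ioi_rpow (-(1 / 2)) ?_
  have hm : Measurable fun r : ℝ => 1 / √r := by fun_prop
  have : IntegrableOn (fun r : ℝ => 1 / √r) (Ioi 0) := by
    refine ⟨hm.aestronglyMeasurable, ?_⟩
    rw [hasFiniteIntegral_iff_ofReal (ae_of_all _ fun r => by positivity)]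
    exact lt_top_iff_ne_top.2 h
  refine this.congr_fun (fun r hr => ?_) measurableSet_Ioi
  beta_reduce
  rw [Real.rpow_neg (mem_Ioi.1 hr).le, ← Real.sqrt_eq_rpow, one_div]

theorem lintegral_inv_sqrt_mul_exp {s : ℝ} (hs : 0 < s) :
    ∫⁻ r in Ioi (0 : ℝ), ENNReal.ofReal (1 / √r * Real.exp (-(s * r))) =
      ENNReal.ofReal √(Real.pi / s) := by
  have hI := Real.integral_rpow_mul_exp_neg_mul_Ioi (a := 1 / 2) (r := s) (by norm_num) hs
  have hval : (1 / s) ^ (1 / 2 : ℝ) * Real.Gamma (1 / 2) = √(Real.pi / s) := by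
    rw [Real.Gamma_one_half_eq, ← Real.sqrt_eq_rpow, ← Real.sqrt_mul (by positivity)]
    congr 1
    ring
  rw [hval] at hI
  have hpos : 0 < √(Real.pi / s) := by positivity
  have hfun : ∀ r ∈ Ioi (0 : ℝ), r ^ ((1 / 2 : ℝ) - 1) * Real.exp (-(s * r)) =
      1 / √r * Real.exp (-(s * r)) := by
    intro r hr
    rw [show (1 / 2 : ℝ) - 1 = -(1 / 2) by norm_num, Real.rpow_neg (mem_Ioi.1 hr).le,
      ← Real.sqrt_eq_rpow, one_div]
  rw [setIntegral_congr_fun measurableSet_Ioi hfun] at hI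
  rw [← hI, ofReal_integral_eq_lintegral_ofReal ?_ (ae_of_all _ fun r => by positivity)]
  by_contra h
  rw [integral_undef h] at hI
  exact hpos.ne hI

/-- Writing `s^(-1/2)` as a mixture of exponentials prepares for the Laplace transform of `S_t`. The
case `s = 0` is needed since `S_t` may vanish; the integral is then infinite. -/
theorem IsFilteredBM.measure_lt_mirrorTime_le_lintegral (hB : IsFilteredBM P ℱ B) {x : Eucl d}
    (h0 : ∀ ω, B 0 ω = x) (y : Eucl d) (s : ℝ≥0) :
    P {ω | (s : ℝ≥0∞) < mirrorTime x y B ω} ≤ ENNReal.ofReal (‖x - y‖ / (2 * Real.pi)) *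
      ∫⁻ r in Ioi (0 : ℝ), ENNReal.ofReal (1 / √r * Real.exp (-(r * s))) := by
  rcases eq_or_ne x y with rfl | hxy
  · simp [mirrorTime_self]
  have hn : 0 < ‖x - y‖ := norm_pos_iff.2 (sub_ne_zero.2 hxy)
  rcases eq_or_ne s 0 with rfl | hs
  · simp only [NNReal.coe_zero, mul_zero, neg_zero, Real.exp_zero, mul_one]
    rw [lintegral_inv_sqrt_mul_exp_zero, ENNReal.mul_top]
    · exact le_top
    · rw [Ne, ENNReal.ofReal_eq_zero, not_le]; positivity
  · have hs' : (0 : ℝ) < s := NNReal.coe_pos.2 (pos_iff_ne_zero.2 hs)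
    simp_rw [mul_comm _ (s : ℝ)]
    rw [lintegral_inv_sqrt_mul_exp hs', ← ENNReal.ofReal_mul (by positivity)]
    refine (hB.measure_lt_mirrorTime_le h0 y hs).trans (ENNReal.ofReal_le_ofReal (le_of_eq ?_))
    rw [Real.sqrt_div Real.pi_pos.le, Real.sqrt_mul Real.pi_pos.le]
    have h1 : 0 < √Real.pi := by positivity
    have h2 : 0 < √(s : ℝ) := by positivity
    have h3 := Real.sq_sqrt Real.pi_pos.le
    field_simp
    rw [h3]

end ReflectionPrinciple

/-! ### The coupling time after subordination. -/

section CouplingTime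

variable {d : ℕ} {Ω : Type*} {x y : Eucl d} {B : ℝ≥0 → Ω → Eucl d} {S : ℝ≥0 → Ω → ℝ≥0} {ω : Ω}

/-- Before `τ` the processes differ, since a fixed point of the reflection lies on the mirror; from
`τ` on they agree. If `S t < τ`, monotonicity handles times up to `t`, and right continuity keeps
`S` below `τ` slightly longer, whence strictness. -/
theorem lt_reflectionCouplingTime_iff (hr : RegularPaths B S) (h0 : B 0 ω = x) (t : ℝ≥0) :
    (t : ℝ≥0∞) < reflectionCouplingTime x y B S ω ↔
      ((S t ω : ℝ≥0) : ℝ≥0∞) < mirrorTime x y B ω := by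
  have hB := hr.continuous ω
  constructor
  · intro h
    by_contra! hle
    refine absurd h (not_lt.2 ?_)
    exact iInf₂_le t (mirrorProcess_of_le hB h0 hle).symm
  · intro h
    have hev : ∀ᶠ u in 𝓝[≥] t, ((S u ω : ℝ≥0) : ℝ≥0∞) < mirrorTime x y B ω :=
      (ENNReal.continuous_coe.continuousAt.comp_continuousWithinAt (hr.right_continuous ω t))
        |>.eventually
        (gt_mem_nhds h)
    obtain ⟨t', ht', hsub⟩ := (mem_nhdsGE_iff_exists_Ico_subset' (show t < t + 1 by simp)).1 hev
    refine lt_of_lt_of_le (show (t : ℝ≥0∞) < t' by exact_mod_cast ht') ?_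
    refine le_iInf₂ fun u hu => ?_
    by_contra! hlt
    have hlt' : u < t' := by exact_mod_cast hlt
    have hSu : ((S u ω : ℝ≥0) : ℝ≥0∞) < mirrorTime x y B ω := by
      rcases le_or_gt u t with hut | hut
      · exact lt_of_le_of_lt (by exact_mod_cast hr.monotone ω hut) h
      · exact hsub ⟨hut.le, hlt'⟩
    have h1 : B (S u ω) ω = mirrorProcess x y B (S u ω) ω := hu
    rw [mirrorProcess_of_lt hSu] at h1
    have h2 := mirrorDist_eq_zero_of_reflect h1.symm
    have h3 := (lt_mirrorTime_iff hB h0 (S u ω)).1 hSu _ le_rfl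
    exact h3.ne' h2

theorem subordinate_eq_of_reflectionCouplingTime_le (hr : RegularPaths B S) (h0 : B 0 ω = x)
    {t : ℝ≥0} (h : reflectionCouplingTime x y B S ω ≤ t) :
    subordinate B S t ω = subordinate (mirrorProcess x y B) S t ω := by
  rw [← not_lt, lt_reflectionCouplingTime_iff hr h0, not_lt] at h
  exact (mirrorProcess_of_le (hr.continuous ω) h0 h).symm

end CouplingTime

/-! ### The total variation estimate. -/

section ReflectionCoupling

theorem setIntegral_exp_of_indep {d : ℕ} {Ω : Type*} {m m0 : MeasurableSpace Ω} {P : Measure Ω}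
    [IsProbabilityMeasure P] (hm : m ≤ m0) {D : Ω → Eucl d}
    (hD : Measurable D) (h : Indep m (MeasurableSpace.comap D inferInstance) P) {G : Set Ω}
    (hG : MeasurableSet[m] G) (ξ : Eucl d) :
    ∫ ω in G, Complex.exp (inner ℝ (D ω) ξ * Complex.I) ∂P = P.real G * charFun (P.map D) ξ := by
  have key := integral_mul_exp_of_indep hm hD h (Z := G.indicator fun _ => 1) (V := fun _ => ξ)
    (measurable_const.indicator hG) measurable_const fun ω => by by_cases h : ω ∈ G <;> simp [h]
  rw [setIntegral_eq_integral_indicator_mul (hm _ hG)]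
  refine key.trans ?_
  rw [integral_mul_const, integral_indicator_const _ (hm _ hG)]
  simp

variable {d : ℕ} {Ω : Type*} [m0 : MeasurableSpace Ω] {P : Measure Ω} {f : ℝ → ℝ}
  {B : ℝ≥0 → Ω → Eucl d} {S : ℝ≥0 → Ω → ℝ≥0} {ℱ : Filtration ℝ≥0 m0}

/-- The filtration generated by a process. -/
def pastFiltration (B : ℝ≥0 → Ω → Eucl d) (hm : ∀ t, Measurable (B t)) : Filtration ℝ≥0 m0 where
  seq s := MeasurableSpace.comap (fun ω (r : Iic s) => B r ω) inferInstance
  mono' s t hst := by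
    have h : Measurable[MeasurableSpace.comap (fun ω (r : Iic t) => B r ω) inferInstance]
        fun ω (r : Iic s) => B r ω := by
      have hg : Measurable fun (w : Iic t → Eucl d) (r : Iic s) => w ⟨r, r.2.trans hst⟩ :=
        measurable_pi_lambda _ fun r => measurable_pi_apply _
      exact hg.comp (comap_measurable _)
    exact h.comap_le
  le' s := (measurable_pi_lambda _ fun r : Iic s => hm r).comap_le

theorem iSup_pastFiltration_le (hm : ∀ t, Measurable (B t)) :
    (⨆ t, pastFiltration B hm t) ≤ MeasurableSpace.comap (fun ω t => B t ω) inferInstance := by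
  refine iSup_le fun s => ?_
  have hg : Measurable fun (w : ℝ≥0 → Eucl d) (r : Iic s) => w r :=
    measurable_pi_lambda _ fun r => measurable_pi_apply _
  have h : Measurable[MeasurableSpace.comap (fun ω t => B t ω) inferInstance]
      fun ω (r : Iic s) => B r ω := hg.comp (comap_measurable _)
  exact h.comap_le

theorem IsSubordination.isFilteredBM [IsProbabilityMeasure P] (hX : IsSubordination P B S f)
    (hr : RegularPaths B S) : IsFilteredBM P (pastFiltration B hX.brownian.measurable) B where
  adapted t := by
    have : Measurable fun w : Iic t → Eucl d => w ⟨t, self_mem_Iic⟩ :=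
      measurable_pi_apply (⟨t, self_mem_Iic⟩ : Iic t)
    exact this.comp (comap_measurable _)
  continuous := hr.continuous
  setIntegral_exp s h G hG ξ := by
    have hle := (pastFiltration B hX.brownian.measurable).le s
    have hi := hX.brownian.indep_increments s h
    rw [IndepFun_iff_Indep] at hi
    have hD : Measurable fun ω => B (s + h) ω - B s ω :=
      (hX.brownian.measurable _).sub (hX.brownian.measurable _)
    rw [setIntegral_exp_of_indep hle hD hi.symm hG, hX.brownian.charFun_increments s h ξ]

theorem IsSubordination.indep_iSup_pastFiltration (hX : IsSubordination P B S f) :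
    Indep (⨆ t, pastFiltration B hX.brownian.measurable t)
      (MeasurableSpace.comap (fun ω t => S t ω) inferInstance) P := by
  have h := hX.indep
  rw [IndepFun_iff_Indep] at h
  exact indep_of_indep_of_le_left h (iSup_pastFiltration_le _)

/-- Independence is required of the whole filtration, so that every Brownian motion adapted to it,
the mirror process included, can be subordinated by the same `S`. -/
theorem IsFilteredBM.isSubordination [IsProbabilityMeasure P] (hB : IsFilteredBM P ℱ B)
    (hS : IsSubordinator P S) (hL : HasLaplaceExponent P S f)
    (hind : Indep (⨆ t, ℱ t) (MeasurableSpace.comap (fun ω t => S t ω) inferInstance) P) :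
    IsSubordination P B S f where
  brownian := hB.isBrownianMotion
  subordinator := hS
  laplace := hL
  indep := by
    rw [IndepFun_iff_Indep]
    have hm : Measurable[⨆ t, ℱ t] fun ω t => B t ω :=
      @measurable_pi_lambda _ _ _ (⨆ t, ℱ t) _ _ fun t =>
        (hB.adapted t).mono (le_iSup (fun t => (ℱ t : MeasurableSpace Ω)) t) le_rfl
    exact indep_of_indep_of_le_left hind hm.comap_le

theorem measurable_mirrorTime {Ω : Type*} {m : MeasurableSpace Ω} {B : ℝ≥0 → Ω → Eucl d}
    (hB : ∀ ω, Continuous fun t => B t ω)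
    {X Y : Ω → Eucl d} (h0 : ∀ ω, B 0 ω = X ω) (hBm : ∀ u, Measurable[m] (B u))
    (hX : Measurable[m] X) (hY : Measurable[m] Y) :
    Measurable[m] fun ω => mirrorTime (X ω) (Y ω) B ω := by
  refine @measurable_of_Ioi ℝ≥0∞ Ω _ _ _ m _ _ _ _ fun a => ?_
  rcases eq_or_ne a ∞ with rfl | ha
  · simp
  · lift a to ℝ≥0 using ha
    exact measurableSet_lt_mirrorTime hB h0 (fun u _ => hBm u) hX hY

theorem indepFun_mirrorTime (hX : IsSubordination P B S f)
    (hr : RegularPaths B S) {x : Eucl d} (h0 : ∀ ω, B 0 ω = x) (y : Eucl d) (t : ℝ≥0) :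
    Measurable (fun ω => mirrorTime x y B ω) ∧
      IndepFun (fun ω => mirrorTime x y B ω) (S t) P := by
  have hBm : ∀ u, Measurable[MeasurableSpace.comap (fun ω t => B t ω) inferInstance] (B u) :=
    fun u => (measurable_pi_apply u).comp (comap_measurable fun ω t => B t ω)
  have hτm : Measurable[MeasurableSpace.comap (fun ω t => B t ω) inferInstance]
      fun ω => mirrorTime x y B ω :=
    measurable_mirrorTime hr.continuous (X := fun _ => x) (Y := fun _ => y) h0 hBm
      measurable_const measurable_const
  refine ⟨hτm.mono (measurable_pi_lambda _ hX.brownian.measurable).comap_le le_rfl, ?_⟩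
  have h := hX.indep
  rw [IndepFun_iff_Indep] at h ⊢
  refine indep_of_indep_of_le_left (indep_of_indep_of_le_right h ?_) hτm.comap_le
  have : Measurable[MeasurableSpace.comap (fun ω t => S t ω) inferInstance] (S t) :=
    (measurable_pi_apply t).comp (comap_measurable fun ω t => S t ω)
  exact this.comap_le

variable [IsProbabilityMeasure P]

theorem lintegral_exp_subordinator (hX : IsSubordination P B S f) (t : ℝ≥0) {r a : ℝ} (hr : 0 < r)
    (ha : 0 ≤ a) :
    ∫⁻ ω, ENNReal.ofReal (a * Real.exp (-(r * (S t ω : ℝ)))) ∂P =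
      ENNReal.ofReal (a * Real.exp (-((t : ℝ) * f r))) := by
  have hm : Measurable fun s : ℝ≥0 => Real.exp (-(r * (s : ℝ))) := by fun_prop
  have h := hX.laplace t r hr
  rw [integral_map (hX.subordinator.measurable t).aemeasurable hm.aestronglyMeasurable] at h
  rw [← h, ← integral_const_mul, ofReal_integral_eq_lintegral_ofReal]
  · refine Integrable.const_mul (Integrable.of_bound
      (hm.comp (hX.subordinator.measurable t)).aestronglyMeasurable 1 (ae_of_all _ fun ω => ?_)) a
    rw [Function.comp_apply, Real.norm_of_nonneg (Real.exp_pos _).le, Real.exp_le_one_iff,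
      neg_nonpos]
    positivity
  · exact ae_of_all _ fun ω => by positivity

theorem two_mul_measure_lt_reflectionCouplingTime_le (hX : IsSubordination P B S f)
    (hr : RegularPaths B S) {x : Eucl d} (h0 : ∀ ω, B 0 ω = x) (y : Eucl d) (t : ℝ≥0) :
    2 * P {ω | (t : ℝ≥0∞) < reflectionCouplingTime x y B S ω} ≤
      ENNReal.ofReal (‖x - y‖ / Real.pi) *
        ∫⁻ r in Ioi (0 : ℝ), ENNReal.ofReal (1 / √r * Real.exp (-((t : ℝ) * f r))) := by
  have hB := hX.isFilteredBM hr
  obtain ⟨hτm0, hind⟩ := indepFun_mirrorTime hX hr h0 y t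
  have hA : MeasurableSet {p : ℝ≥0∞ × ℝ≥0 | (p.2 : ℝ≥0∞) < p.1} :=
    measurableSet_lt (measurable_coe_nnreal_ennreal.comp measurable_snd) measurable_fst
  have hF : Measurable ({p : ℝ≥0∞ × ℝ≥0 | (p.2 : ℝ≥0∞) < p.1}.indicator fun _ => (1 : ℝ≥0∞)) :=
    measurable_const.indicator hA
  have key := IndepFun.lintegral_prod_eq hind hτm0
    (hX.subordinator.measurable t) hF
  have hSm := hX.subordinator.measurable t
  have hL : ∫⁻ ω, {p : ℝ≥0∞ × ℝ≥0 | (p.2 : ℝ≥0∞) < p.1}.indicator (fun _ => (1 : ℝ≥0∞))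
      (mirrorTime x y B ω, S t ω) ∂P =
      P {ω | (t : ℝ≥0∞) < reflectionCouplingTime x y B S ω} := by
    have hset : {ω | (t : ℝ≥0∞) < reflectionCouplingTime x y B S ω} =
        (fun ω => (mirrorTime x y B ω, S t ω)) ⁻¹' {p : ℝ≥0∞ × ℝ≥0 | (p.2 : ℝ≥0∞) < p.1} := by
      ext ω
      exact lt_reflectionCouplingTime_iff hr (h0 ω) t
    rw [hset, ← lintegral_indicator_one ((hτm0.prodMk hSm) hA)]
    rfl
  have hR : ∀ s : ℝ≥0, ∫⁻ ω, {p : ℝ≥0∞ × ℝ≥0 | (p.2 : ℝ≥0∞) < p.1}.indicator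
      (fun _ => (1 : ℝ≥0∞)) (mirrorTime x y B ω, s) ∂P =
      P {ω | (s : ℝ≥0∞) < mirrorTime x y B ω} := by
    intro s
    rw [← lintegral_indicator_one (measurableSet_lt measurable_const hτm0)]
    rfl
  rw [hL] at key
  simp only [hR] at key
  rw [key]
  -- Tonelli, then the Laplace transform of `S_t` for each fixed `r`.
  have hswap : ∫⁻ ω, (∫⁻ r in Ioi (0 : ℝ),
      ENNReal.ofReal (1 / √r * Real.exp (-(r * (S t ω : ℝ))))) ∂P =
      ∫⁻ r in Ioi (0 : ℝ), ENNReal.ofReal (1 / √r * Real.exp (-((t : ℝ) * f r))) := by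
    rw [lintegral_lintegral_swap]
    · refine setLIntegral_congr_fun measurableSet_Ioi fun r hr => ?_
      exact lintegral_exp_subordinator hX t (mem_Ioi.1 hr) (by positivity)
    · have : Measurable fun p : Ω × ℝ =>
          ENNReal.ofReal (1 / √p.2 * Real.exp (-(p.2 * (S t p.1 : ℝ)))) := by fun_prop
      exact this.aemeasurable
  calc 2 * ∫⁻ ω, P {ω' | (S t ω : ℝ≥0∞) < mirrorTime x y B ω'} ∂P
      ≤ 2 * ∫⁻ ω, ENNReal.ofReal (‖x - y‖ / (2 * Real.pi)) * (∫⁻ r in Ioi (0 : ℝ),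
          ENNReal.ofReal (1 / √r * Real.exp (-(r * (S t ω : ℝ))))) ∂P := by
        gcongr with ω
        exact hB.measure_lt_mirrorTime_le_lintegral h0 y _
    _ = 2 * (ENNReal.ofReal (‖x - y‖ / (2 * Real.pi)) * ∫⁻ r in Ioi (0 : ℝ),
          ENNReal.ofReal (1 / √r * Real.exp (-((t : ℝ) * f r)))) := by
        rw [lintegral_const_mul' _ _ ENNReal.ofReal_ne_top, hswap]
    _ = _ := by
        rw [← mul_assoc]
        congr 1
        have h2 : (2 : ℝ≥0∞) = ENNReal.ofReal (2 : ℝ) := (ENNReal.ofReal_ofNat 2).symm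
        have h3 : ‖x - y‖ / Real.pi = 2 * (‖x - y‖ / (2 * Real.pi)) := by
          have := Real.pi_pos
          field_simp
        rw [h3, ENNReal.ofReal_mul zero_le_two, ← h2]

theorem IsSubordination.mirror (hX : IsSubordination P B S f) (hr : RegularPaths B S)
    {x : Eucl d} (h0 : ∀ ω, B 0 ω = x) (y : Eucl d) :
    IsSubordination P (mirrorProcess x y B) S f ∧ RegularPaths (mirrorProcess x y B) S := by
  have hW := (hX.isFilteredBM hr).mirror (X := fun _ => x) (Y := fun _ => y) h0
    measurable_const
  exact ⟨hW.isSubordination hX.subordinator hX.laplace hX.indep_iSup_pastFiltration,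
    ⟨hW.continuous, hr.start, hr.monotone, hr.right_continuous⟩⟩

theorem varNorm_transitionFunction_le (hX : IsSubordination P B S f) (hr : RegularPaths B S)
    {x : Eucl d} (h0 : ∀ ω, B 0 ω = x) (y : Eucl d) (t : ℝ≥0) :
    varNorm (transitionFunction P (subordinate B S) t x)
      (transitionFunction P (subordinate B S) t y) ≤
      2 * P {ω | (t : ℝ≥0∞) < reflectionCouplingTime x y B S ω} := by
  obtain ⟨hX', hr'⟩ := hX.mirror hr h0 y
  refine varNorm_le_two_mul (P := P) (measurable_subordinate hX hr t)
    (measurable_subordinate hX' hr' t) _ _ (transitionFunction_eq_map hr h0 t).symm ?_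
    (measure_mono fun ω hω => ?_)
  · rw [transitionFunction_eq hX hX']
    exact (transitionFunction_eq_map hr' (fun ω => mirrorProcess_zero (h0 ω)) t).symm
  · by_contra hle
    exact hω (subordinate_eq_of_reflectionCouplingTime_le hr (h0 ω) (not_lt.1 hle))

/-- The total variation estimate by the reflection-subordinate coupling. -/
theorem varNorm_le_reflectionCoupling {Ω₀ : Type*} [MeasurableSpace Ω₀] {P₀ : Measure Ω₀}
    [IsProbabilityMeasure P₀] {B₀ : ℝ≥0 → Ω₀ → Eucl d} {S₀ : ℝ≥0 → Ω₀ → ℝ≥0}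
    (hX₀ : IsSubordination P₀ B₀ S₀ f) (hX : IsSubordination P B S f) {x : Eucl d}
    (hx : ∀ᵐ ω ∂P, B 0 ω = x) (y : Eucl d) (t : ℝ≥0) :
    varNorm (transitionFunction P₀ (subordinate B₀ S₀) t x)
      (transitionFunction P₀ (subordinate B₀ S₀) t y) ≤
      2 * P {ω | (t : ℝ≥0∞) < reflectionCouplingTime x y B S ω} ∧
    2 * P {ω | (t : ℝ≥0∞) < reflectionCouplingTime x y B S ω} ≤
      ENNReal.ofReal (‖x - y‖ / Real.pi) *
        ∫⁻ r in Ioi (0 : ℝ), ENNReal.ofReal (1 / √r * Real.exp (-((t : ℝ) * f r))) := by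
  obtain ⟨B', S', hX', hr', h0, hB, hS⟩ := hX.exists_regular x (fun w => w 0 = x) rfl hx
  have hset : P {ω | (t : ℝ≥0∞) < reflectionCouplingTime x y B S ω} =
      P {ω | (t : ℝ≥0∞) < reflectionCouplingTime x y B' S' ω} := by
    refine measure_congr ?_
    filter_upwards [hB, hS] with ω h1 h2
    -- The coupling time at `ω` depends only on the two paths at `ω`, so it can be computed on a
    -- one-point space.
    have hT : reflectionCouplingTime x y B S ω = reflectionCouplingTime x y B' S' ω :=
      congrArg₂ (fun (w : ℝ≥0 → Eucl d) (σ : ℝ≥0 → ℝ≥0) =>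
        reflectionCouplingTime x y (fun t (_ : Unit) => w t) (fun t _ => σ t) ())
        (funext h1) (funext h2)
    exact congrArg (fun T => (t : ℝ≥0∞) < T) hT
  rw [hset]
  refine ⟨?_, two_mul_measure_lt_reflectionCouplingTime_le hX' hr' h0 y t⟩
  have h := varNorm_transitionFunction_le hX' hr' h0 y t
  simp only [transitionFunction_eq hX₀ hX']
  exact h

end ReflectionCoupling

/-! ### Transfer to a product space. -/

section Transfer

variable {Ω Ω' : Type*} [MeasurableSpace Ω] [MeasurableSpace Ω'] {P : Measure Ω} {Q : Measure Ω'}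
  {φ : Ω' → Ω} {S : ℝ≥0 → Ω → ℝ≥0} {f : ℝ → ℝ}

theorem IndepFun.comp_measurePreserving {α β : Type*} [MeasurableSpace α] [MeasurableSpace β]
    {g : Ω → α} {h : Ω → β} (hφ : MeasurePreserving φ Q P) (hg : Measurable g)
    (hh : Measurable h) (hi : IndepFun g h P) :
    IndepFun (fun ω => g (φ ω)) (fun ω => h (φ ω)) Q := by
  rw [indepFun_iff_measure_inter_preimage_eq_mul] at hi ⊢
  intro s t hs ht
  have key := hi s t hs ht
  rw [← hφ.measure_preimage ((hg hs).inter (hh ht)).nullMeasurableSet,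
    ← hφ.measure_preimage (hg hs).nullMeasurableSet,
    ← hφ.measure_preimage (hh ht).nullMeasurableSet] at key
  exact key

theorem IsSubordinator.comp_measurePreserving (hφ : MeasurePreserving φ Q P)
    (hS : IsSubordinator P S) : IsSubordinator Q fun t ω => S t (φ ω) where
  measurable t := (hS.measurable t).comp hφ.measurable
  start := hφ.quasiMeasurePreserving.ae hS.start
  monotone_paths := hφ.quasiMeasurePreserving.ae hS.monotone_paths
  right_continuous_paths := hφ.quasiMeasurePreserving.ae hS.right_continuous_paths
  indep_increments s h := by
    refine IndepFun.comp_measurePreserving hφ ?_ ?_ (hS.indep_increments s h)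
    · exact ((hS.measurable _).coe_nnreal_real).sub ((hS.measurable _).coe_nnreal_real)
    · exact measurable_pi_lambda _ fun r => hS.measurable r
  stationary_increments s h := by
    have h1 : Measurable fun ω => (S (s + h) ω : ℝ) - S s ω :=
      ((hS.measurable _).coe_nnreal_real).sub ((hS.measurable _).coe_nnreal_real)
    have h2 : Measurable fun ω => (S h ω : ℝ) := (hS.measurable h).coe_nnreal_real
    refine ⟨(h1.comp hφ.measurable).aemeasurable, (h2.comp hφ.measurable).aemeasurable, ?_⟩
    have key := (hS.stationary_increments s h).map_eq
    rw [← hφ.map_eq, Measure.map_map h1 hφ.measurable, Measure.map_map h2 hφ.measurable] at key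
    exact key

theorem HasLaplaceExponent.comp_measurePreserving (hφ : MeasurePreserving φ Q P)
    (hS : ∀ t, Measurable (S t)) (hL : HasLaplaceExponent P S f) :
    HasLaplaceExponent Q (fun t ω => S t (φ ω)) f := by
  intro t lam hl
  have key := hL t lam hl
  rw [← hφ.map_eq, Measure.map_map (hS t) hφ.measurable] at key
  exact key

/-- For a fixed second coordinate the section of an event lies in `m`, so the product formula holds
section by section and is then integrated. -/
theorem Indep.prod_left {Ω : Type*} {m m0 : MeasurableSpace Ω} {P : Measure Ω}
    [IsProbabilityMeasure P]
    (hm : m ≤ m0) {β γ : Type*} [MeasurableSpace β] [mγ : MeasurableSpace γ] (ν : Measure γ)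
    [IsProbabilityMeasure ν] {D : Ω → β} (hD : Measurable D)
    (h : Indep m (MeasurableSpace.comap D inferInstance) P) :
    Indep (m.prod mγ) (MeasurableSpace.comap (fun p : Ω × γ => D p.1) inferInstance)
      (P.prod ν) := by
  rw [Indep_iff] at h ⊢
  rintro G _ hG ⟨A, hA, rfl⟩
  have hle : m.prod mγ ≤ m0.prod mγ := sup_le_sup_right (MeasurableSpace.comap_mono hm) _
  have hG0 : MeasurableSet G := hle _ hG
  have hDA : MeasurableSet ((fun p : Ω × γ => D p.1) ⁻¹' A) := (hD.comp measurable_fst) hA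
  rw [Measure.prod_apply_symm (hG0.inter hDA), Measure.prod_apply_symm hG0,
    Measure.prod_apply_symm hDA]
  have hsec : ∀ y : γ, P ((fun ω => (ω, y)) ⁻¹' (G ∩ (fun p : Ω × γ => D p.1) ⁻¹' A)) =
      P ((fun ω => (ω, y)) ⁻¹' G) * P (D ⁻¹' A) := by
    intro y
    have hy : Measurable[m, m.prod mγ] fun ω : Ω => (ω, y) :=
      @measurable_prodMk_right Ω γ m mγ y
    exact h _ _ (hy hG) ⟨A, hA, rfl⟩
  have hsec' : ∀ y : γ, P ((fun ω => (ω, y)) ⁻¹' ((fun p : Ω × γ => D p.1) ⁻¹' A)) =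
      P (D ⁻¹' A) := fun y => rfl
  simp only [hsec, hsec', lintegral_const, measure_univ, mul_one]
  exact lintegral_mul_const _ (measurable_measure_prodMk_right hG0)

end Transfer

/-! ### Random starting points and the coupling property. -/

section SuccessfulCoupling

variable {d : ℕ} {Ω : Type*} [m0 : MeasurableSpace Ω] {P : Measure Ω}
  {f : ℝ → ℝ} {B : ℝ≥0 → Ω → Eucl d} {S : ℝ≥0 → Ω → ℝ≥0} {ℱ : Filtration ℝ≥0 m0}

/-- Brownian motion with its start moved to `x`. -/
def startAt (B : ℝ≥0 → Ω → Eucl d) (x : Eucl d) : ℝ≥0 → Ω → Eucl d :=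
  fun t ω => x + (B t ω - B 0 ω)

theorem IsFilteredBM.startAt (hB : IsFilteredBM P ℱ B) (x : Eucl d) :
    IsFilteredBM P ℱ (startAt B x) where
  adapted t := measurable_const.add
    ((hB.adapted t).sub ((hB.adapted 0).mono (ℱ.mono zero_le) le_rfl))
  continuous ω := continuous_const.add ((hB.continuous ω).sub continuous_const)
  setIntegral_exp s h G hG ξ := by
    rw [← hB.setIntegral_exp s h G hG ξ]
    have : ∀ ω, SubordinateBM.startAt B x (s + h) ω - SubordinateBM.startAt B x s ω =
        B (s + h) ω - B s ω := fun ω => by simp only [SubordinateBM.startAt]; abel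
    simp only [this]

variable [IsProbabilityMeasure P]

theorem IsFilteredBM.measure_mirrorTime_eq_top (hB : IsFilteredBM P ℱ B) {x : Eucl d}
    (h0 : ∀ ω, B 0 ω = x) (y : Eucl d) : P {ω | mirrorTime x y B ω = ∞} = 0 := by
  have hlim : Tendsto (fun n : ℕ => ENNReal.ofReal
      (‖x - y‖ / (2 * √(Real.pi * ((n + 1 : ℕ) : ℝ≥0))))) atTop (𝓝 0) := by
    rw [← ENNReal.ofReal_zero]
    refine ENNReal.tendsto_ofReal (Tendsto.div_atTop tendsto_const_nhds ?_)
    refine Tendsto.const_mul_atTop two_pos (Real.tendsto_sqrt_atTop.comp ?_)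
    refine Tendsto.const_mul_atTop Real.pi_pos ?_
    push_cast
    exact tendsto_atTop_add_const_right _ _ tendsto_natCast_atTop_atTop
  refine le_antisymm (ge_of_tendsto' hlim fun n => ?_) zero_le
  refine (measure_mono fun ω hω => ?_).trans
    (hB.measure_lt_mirrorTime_le h0 y (s := (n + 1 : ℕ)) (by simp))
  rw [mem_ofPred_eq] at hω ⊢
  rw [hω]
  exact ENNReal.coe_lt_top

/-- Markov's inequality for `e^(-λ S_n)` gives `P(S_n ≤ K) ≤ e^(λK) e^(-n f(λ))`, which tends to
zero. -/
theorem ae_subordinator_unbounded (hX : IsSubordination P B S f) {lam : ℝ} (hl : 0 < lam)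
    (hf : 0 < f lam) : ∀ᵐ ω ∂P, ∀ K : ℕ, ∃ n : ℕ, (K : ℝ≥0) < S n ω := by
  rw [ae_all_iff]
  intro K
  have hle : ∀ n : ℕ, Real.exp (-(lam * K)) * P.real {ω | ∀ n : ℕ, S n ω ≤ K} ≤
      Real.exp (-((n : ℝ) * f lam)) := by
    intro n
    have hm : Measurable fun s : ℝ≥0 => Real.exp (-(lam * (s : ℝ))) := by fun_prop
    have h := hX.laplace n lam hl
    rw [integral_map (hX.subordinator.measurable n).aemeasurable hm.aestronglyMeasurable] at h
    rw [NNReal.coe_natCast] at h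
    rw [← h]
    have hint : Integrable (fun ω => Real.exp (-(lam * (S n ω : ℝ)))) P := by
      refine Integrable.of_bound (hm.comp (hX.subordinator.measurable n)).aestronglyMeasurable 1
        (ae_of_all _ fun ω => ?_)
      rw [Real.norm_of_nonneg (Real.exp_pos _).le, Real.exp_le_one_iff, neg_nonpos]
      positivity
    refine le_trans ?_ (mul_meas_ge_le_integral_of_nonneg (ae_of_all _ fun ω =>
      (Real.exp_pos _).le) hint (Real.exp (-(lam * K))))
    refine mul_le_mul_of_nonneg_left (measureReal_mono fun ω hω => ?_) (Real.exp_pos _).le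
    rw [mem_ofPred_eq] at hω ⊢
    have : (S n ω : ℝ) ≤ K := by exact_mod_cast hω n
    gcongr
  have hlim : Tendsto (fun n : ℕ => Real.exp (-((n : ℝ) * f lam))) atTop (𝓝 0) :=
    Real.tendsto_exp_neg_atTop_nhds_zero.comp
      (Tendsto.atTop_mul_const hf tendsto_natCast_atTop_atTop)
  have h0 : Real.exp (-(lam * K)) * P.real {ω | ∀ n : ℕ, S n ω ≤ K} ≤ 0 :=
    ge_of_tendsto' hlim hle
  have h1 : P.real {ω | ∀ n : ℕ, S n ω ≤ K} = 0 := by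
    refine le_antisymm ?_ measureReal_nonneg
    exact nonpos_of_mul_nonpos_right h0 (Real.exp_pos _)
  rw [measureReal_eq_zero_iff] at h1
  refine (measure_eq_zero_iff_ae_notMem.1 h1).mono fun ω hω => ?_
  rw [mem_ofPred_eq] at hω
  push Not at hω
  exact hω

/-- The product filtration that adds the information in an independent second component. -/
def prodFiltration {γ : Type*} [mγ : MeasurableSpace γ] (ℱ : Filtration ℝ≥0 m0) :
    Filtration ℝ≥0 (m0.prod mγ) where
  seq s := (ℱ s).prod mγ
  mono' _ _ hst := sup_le_sup_right (MeasurableSpace.comap_mono (ℱ.mono hst)) _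
  le' s := sup_le_sup_right (MeasurableSpace.comap_mono (ℱ.le s)) _

/-- Brownian motion with a random start, given by the second component. -/
def randomStart (B : ℝ≥0 → Ω → Eucl d) : ℝ≥0 → Ω × (Eucl d × Eucl d) → Eucl d :=
  fun t p => startAt B p.2.1 t p.1

theorem IsFilteredBM.randomStart (hB : IsFilteredBM P ℱ B) (ν : Measure (Eucl d × Eucl d))
    [IsProbabilityMeasure ν] :
    IsFilteredBM (P.prod ν) (prodFiltration ℱ) (randomStart B) where
  adapted t := by
    have h1 : Measurable[(ℱ t).prod inferInstance, ℱ t] fun p : Ω × (Eucl d × Eucl d) => p.1 :=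
      @measurable_fst Ω (Eucl d × Eucl d) (ℱ t) _
    have h2 : Measurable[(ℱ t).prod inferInstance] fun p : Ω × (Eucl d × Eucl d) => p.2 :=
      @measurable_snd Ω (Eucl d × Eucl d) (ℱ t) _
    have h3 : Measurable[ℱ t] fun ω => B t ω - B 0 ω :=
      (hB.adapted t).sub ((hB.adapted 0).mono (ℱ.mono zero_le) le_rfl)
    exact (measurable_fst.comp h2).add (h3.comp h1)
  continuous p := (hB.startAt p.2.1).continuous p.1
  setIntegral_exp s h G hG ξ := by
    have hD : Measurable fun ω => B (s + h) ω - B s ω := (hB.measurable _).sub (hB.measurable _)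
    obtain ⟨hφ, hi⟩ := hB.increment s h
    have hind := Indep.prod_left (ℱ.le s) ν hD hi
    have hinc : ∀ p : Ω × (Eucl d × Eucl d), SubordinateBM.randomStart B (s + h) p -
        SubordinateBM.randomStart B s p = B (s + h) p.1 - B s p.1 := fun p => by
      simp only [SubordinateBM.randomStart, SubordinateBM.startAt]; abel
    simp only [hinc]
    have hmap : (P.prod ν).map (fun p => B (s + h) p.1 - B s p.1) =
        P.map fun ω => B (s + h) ω - B s ω := by
      have h1 := Measure.map_map (μ := P.prod ν) hD measurable_fst
      rw [measurePreserving_fst.map_eq] at h1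
      exact h1.symm
    have hD' : Measurable fun p : Ω × (Eucl d × Eucl d) => B (s + h) p.1 - B s p.1 :=
      hD.comp measurable_fst
    rw [setIntegral_exp_of_indep ((prodFiltration ℱ).le s) hD' hind hG, hmap, hφ]

theorem mirrorTime_randomStart {Ω : Type*} {B : ℝ≥0 → Ω → Eucl d} (y : Eucl d × Eucl d) (ω : Ω) :
    mirrorTime y.1 y.2 (randomStart B) (ω, y) = mirrorTime y.1 y.2 (startAt B y.1) ω := rfl

/-- Fubini: for fixed starting points this is the null event of
`IsFilteredBM.measure_mirrorTime_eq_top`. -/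
theorem IsFilteredBM.measure_mirrorTime_randomStart (hB : IsFilteredBM P ℱ B)
    (ν : Measure (Eucl d × Eucl d)) [IsProbabilityMeasure ν] :
    (P.prod ν) {p | mirrorTime p.2.1 p.2.2 (SubordinateBM.randomStart B) p = ∞} = 0 := by
  have hB' := hB.randomStart ν
  have h0 : ∀ p, SubordinateBM.randomStart B 0 p = p.2.1 := fun p => by
    simp [SubordinateBM.randomStart, SubordinateBM.startAt]
  have hτm : Measurable fun p : Ω × (Eucl d × Eucl d) =>
      mirrorTime p.2.1 p.2.2 (SubordinateBM.randomStart B) p :=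
    measurable_mirrorTime hB'.continuous h0 hB'.measurable
      (measurable_fst.comp measurable_snd) (measurable_snd.comp measurable_snd)
  have hτs : MeasurableSet {p : Ω × (Eucl d × Eucl d) |
      mirrorTime p.2.1 p.2.2 (SubordinateBM.randomStart B) p = ∞} :=
    measurableSet_eq_fun hτm measurable_const
  rw [Measure.prod_apply_symm hτs, lintegral_eq_zero_iff (measurable_measure_prodMk_right hτs)]
  refine ae_of_all _ fun y => ?_
  have hsec : (fun ω => (ω, y)) ⁻¹' {p : Ω × (Eucl d × Eucl d) |
      mirrorTime p.2.1 p.2.2 (SubordinateBM.randomStart B) p = ∞} =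
      {ω | mirrorTime y.1 y.2 (SubordinateBM.startAt B y.1) ω = ∞} := by
    ext ω
    simp only [mem_preimage, mem_ofPred_eq, mirrorTime_randomStart]
  beta_reduce
  rw [hsec]
  exact (hB.startAt y.1).measure_mirrorTime_eq_top (fun ω => by simp [SubordinateBM.startAt]) y.2

/-- The mirror process of `randomStart`, whose start is given by the second component, too. -/
def randomMirror (B : ℝ≥0 → Ω → Eucl d) : ℝ≥0 → Ω × (Eucl d × Eucl d) → Eucl d :=
  fun t p => mirrorProcess p.2.1 p.2.2 (randomStart B) t p

theorem randomStart_zero {Ω : Type*} (B : ℝ≥0 → Ω → Eucl d) (p : Ω × (Eucl d × Eucl d)) :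
    randomStart B 0 p = p.2.1 := by simp [randomStart, startAt]

theorem randomMirror_zero {Ω : Type*} (B : ℝ≥0 → Ω → Eucl d) (p : Ω × (Eucl d × Eucl d)) :
    randomMirror B 0 p = p.2.2 := mirrorProcess_zero (randomStart_zero B p)

theorem couplingTime_randomMirror {Ω : Type*} (B : ℝ≥0 → Ω → Eucl d)
    (S : ℝ≥0 → Ω × (Eucl d × Eucl d) → ℝ≥0) (p : Ω × (Eucl d × Eucl d)) :
    couplingTime (subordinate (randomStart B) S) (subordinate (randomMirror B) S) p =
      reflectionCouplingTime p.2.1 p.2.2 (randomStart B) S p := by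
  simp only [reflectionCouplingTime, couplingTime, subordinate, randomMirror]

theorem IsFilteredBM.randomMirror (hB : IsFilteredBM P ℱ B) (ν : Measure (Eucl d × Eucl d))
    [IsProbabilityMeasure ν] :
    IsFilteredBM (P.prod ν) (prodFiltration ℱ) (randomMirror B) := by
  have hsnd : Measurable[prodFiltration ℱ 0] fun p : Ω × (Eucl d × Eucl d) => p.2.2 :=
    measurable_snd.comp (@measurable_snd Ω (Eucl d × Eucl d) (ℱ 0) _)
  exact (hB.randomStart ν).mirror (randomStart_zero B) hsnd

theorem indep_iSup_prodFiltration (hX : IsSubordination P B S f)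
    (ν : Measure (Eucl d × Eucl d)) [IsProbabilityMeasure ν] :
    Indep (⨆ t, prodFiltration (γ := Eucl d × Eucl d)
        (pastFiltration B hX.brownian.measurable) t)
      (MeasurableSpace.comap (fun (p : Ω × (Eucl d × Eucl d)) t => S t p.1) inferInstance)
      (P.prod ν) := by
  have h := hX.indep
  rw [IndepFun_iff_Indep] at h
  have h' := Indep.prod_left (measurable_pi_lambda _ hX.brownian.measurable).comap_le ν
    (measurable_pi_lambda _ hX.subordinator.measurable) h
  refine indep_of_indep_of_le_left h' (iSup_le fun t => ?_)
  exact sup_le_sup_right (MeasurableSpace.comap_mono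
    ((le_iSup (fun t => (pastFiltration B hX.brownian.measurable t : MeasurableSpace Ω)) t).trans
      (iSup_pastFiltration_le _))) _

theorem IsFilteredBM.isSubordination_prod {W : ℝ≥0 → Ω × (Eucl d × Eucl d) → Eucl d}
    (hX : IsSubordination P B S f) (ν : Measure (Eucl d × Eucl d)) [IsProbabilityMeasure ν]
    (hW : IsFilteredBM (P.prod ν)
      (prodFiltration (pastFiltration B hX.brownian.measurable)) W) :
    IsSubordination (P.prod ν) W (fun t p => S t p.1) f :=
  hW.isSubordination (hX.subordinator.comp_measurePreserving measurePreserving_fst)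
    (hX.laplace.comp_measurePreserving measurePreserving_fst hX.subordinator.measurable)
    (indep_iSup_prodFiltration hX ν)

theorem ae_couplingTime_randomStart (hX : IsSubordination P B S f) (hr : RegularPaths B S)
    {lam : ℝ} (hl : 0 < lam) (hf : 0 < f lam) (ν : Measure (Eucl d × Eucl d))
    [IsProbabilityMeasure ν] :
    ∀ᵐ p ∂(P.prod ν),
      reflectionCouplingTime p.2.1 p.2.2 (randomStart B) (fun t p => S t p.1) p < ∞ := by
  have hB := hX.isFilteredBM hr
  have hrB : RegularPaths (randomStart B) fun t (p : Ω × (Eucl d × Eucl d)) => S t p.1 :=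
    ⟨(hB.randomStart ν).continuous, fun p => hr.start p.1, fun p => hr.monotone p.1,
      fun p => hr.right_continuous p.1⟩
  have hfst : MeasurePreserving Prod.fst (P.prod ν) P := measurePreserving_fst
  have hS := hfst.quasiMeasurePreserving.ae (ae_subordinator_unbounded hX hl hf)
  filter_upwards [measure_eq_zero_iff_ae_notMem.1 (hB.measure_mirrorTime_randomStart ν), hS]
    with p hp hpS
  -- Once `S n` exceeds an integer above `τ`, the coupling has happened by time `n`.
  obtain ⟨K, hK⟩ := ENNReal.exists_nat_gt hp
  obtain ⟨n, hn⟩ := hpS K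
  have hle : ¬ (((n : ℝ≥0) : ℝ≥0∞) <
      reflectionCouplingTime p.2.1 p.2.2 (randomStart B) (fun t p => S t p.1) p) := by
    rw [lt_reflectionCouplingTime_iff hrB (randomStart_zero B p), not_lt]
    refine hK.le.trans ?_
    have : ((K : ℝ≥0) : ℝ≥0∞) ≤ S n p.1 := by exact_mod_cast hn.le
    simpa using this
  exact (not_lt.1 hle).trans_lt ENNReal.coe_lt_top

theorem hasCouplingProperty_of_regularPaths {Ω : Type u} [MeasurableSpace Ω] {P : Measure Ω}
    [IsProbabilityMeasure P] {B : ℝ≥0 → Ω → Eucl d} {S : ℝ≥0 → Ω → ℝ≥0}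
    (hX : IsSubordination P B S f) (hr : RegularPaths B S) {lam : ℝ} (hl : 0 < lam)
    (hf : 0 < f lam) :
    HasCouplingProperty.{u} (transitionFunction P (subordinate B S)) := by
  intro μ₁ μ₂ _ _
  have hB := hX.isFilteredBM hr
  have hB' := hB.randomStart (μ₁.prod μ₂)
  have hW := hB.randomMirror (μ₁.prod μ₂)
  have hXB := IsFilteredBM.isSubordination_prod hX (μ₁.prod μ₂) hB'
  have hXW := IsFilteredBM.isSubordination_prod hX (μ₁.prod μ₂) hW
  have hrB : RegularPaths (randomStart B) fun t (p : Ω × (Eucl d × Eucl d)) => S t p.1 :=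
    ⟨hB'.continuous, fun p => hr.start p.1, fun p => hr.monotone p.1,
      fun p => hr.right_continuous p.1⟩
  have hrW : RegularPaths (randomMirror B) fun t (p : Ω × (Eucl d × Eucl d)) => S t p.1 :=
    ⟨hW.continuous, fun p => hr.start p.1, fun p => hr.monotone p.1,
      fun p => hr.right_continuous p.1⟩
  have hm1 : (P.prod (μ₁.prod μ₂)).map (randomStart B 0) = μ₁ := by
    have h : MeasurePreserving (Prod.fst ∘ Prod.snd) (P.prod (μ₁.prod μ₂)) μ₁ :=
      measurePreserving_fst.comp measurePreserving_snd
    rw [show randomStart B 0 = Prod.fst ∘ Prod.snd from funext (randomStart_zero B)]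
    exact h.map_eq
  have hm2 : (P.prod (μ₁.prod μ₂)).map (randomMirror B 0) = μ₂ := by
    have h : MeasurePreserving (Prod.snd ∘ Prod.snd) (P.prod (μ₁.prod μ₂)) μ₂ :=
      measurePreserving_snd.comp measurePreserving_snd
    rw [show randomMirror B 0 = Prod.snd ∘ Prod.snd from funext (randomMirror_zero B)]
    exact h.map_eq
  refine ⟨Ω × (Eucl d × Eucl d), inferInstance, P.prod (μ₁.prod μ₂), inferInstance,
    subordinate (randomStart B) fun t p => S t p.1,
    subordinate (randomMirror B) fun t p => S t p.1, ?_, ?_, ?_⟩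
  · rw [transitionFunction_eq hX hXB]
    exact isMarkovProcess_subordinate hXB hrB hm1
  · rw [transitionFunction_eq hX hXW]
    exact isMarkovProcess_subordinate hXW hrW hm2
  · filter_upwards [ae_couplingTime_randomStart hX hr hl hf (μ₁.prod μ₂)] with p hp
    rw [couplingTime_randomMirror]
    refine ⟨hp, fun t ht => ?_⟩
    rw [subordinate_eq_of_reflectionCouplingTime_le hrB (randomStart_zero B p) ht]
    simp only [subordinate, randomMirror]

theorem IsSubordination.hasCouplingProperty {Ω : Type u} [MeasurableSpace Ω] {P : Measure Ω}
    [IsProbabilityMeasure P] {B : ℝ≥0 → Ω → Eucl d} {S : ℝ≥0 → Ω → ℝ≥0}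
    (hX : IsSubordination P B S f) {lam : ℝ} (hl : 0 < lam) (hf : 0 < f lam) :
    HasCouplingProperty.{u} (transitionFunction P (subordinate B S)) := by
  obtain ⟨B', S', hX', hr', -⟩ := hX.exists_regular 0 (fun _ => True) trivial
    (ae_of_all _ fun _ => trivial)
  rw [transitionFunction_eq hX hX']
  exact hasCouplingProperty_of_regularPaths hX' hr' hl hf

/-- A subordinate Brownian motion started at `x`, for the same Laplace exponent. -/
theorem IsSubordination.exists_startAt (hX : IsSubordination P B S f) (x : Eucl d) :
    ∃ (B' : ℝ≥0 → Ω → Eucl d) (S' : ℝ≥0 → Ω → ℝ≥0), IsSubordination P B' S' f ∧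
      ∀ ω, B' 0 ω = x := by
  obtain ⟨B', S', hX', hr', -⟩ := hX.exists_regular 0 (fun _ => True) trivial
    (ae_of_all _ fun _ => trivial)
  exact ⟨startAt B' x, S', ((hX'.isFilteredBM hr').startAt x).isSubordination hX'.subordinator
    hX'.laplace hX'.indep_iSup_pastFiltration, fun ω => by simp [startAt]⟩

end SuccessfulCoupling

/-! ### Bernstein functions and the decay of the integral. -/

section Bernstein

variable {f : ℝ → ℝ}

theorem IsBernstein.continuousOn (hf : IsBernstein f) : ContinuousOn f (Ioi 0) :=
  hf.contDiffOn.continuousOn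

theorem IsBernstein.monotoneOn (hf : IsBernstein f) : MonotoneOn f (Ioi 0) := by
  refine monotoneOn_of_deriv_nonneg (convex_Ioi 0) hf.continuousOn ?_ ?_
  · rw [interior_Ioi]
    exact hf.contDiffOn.differentiableOn (by simp)
  · intro r hr
    rw [interior_Ioi] at hr
    simpa using hf.alternating 1 le_rfl r hr

theorem IsBernstein.concaveOn (hf : IsBernstein f) : ConcaveOn ℝ (Ioi 0) f := by
  refine concaveOn_of_deriv2_nonpos (convex_Ioi 0) hf.continuousOn ?_ ?_ ?_
  · rw [interior_Ioi]
    exact hf.contDiffOn.differentiableOn (by simp)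
  · rw [interior_Ioi]
    exact (hf.contDiffOn.deriv_of_isOpen (m := 1) isOpen_Ioi (by norm_cast)).differentiableOn
      (by simp)
  · intro r hr
    rw [interior_Ioi] at hr
    have := hf.alternating 2 (by norm_num) r hr
    rw [iteratedDeriv_eq_iterate] at this
    norm_num at this
    simpa using this

/-- By concavity a flat piece would bound all later slopes by zero, contradicting unboundedness. -/
theorem IsBernstein.strictMonoOn (hf : IsBernstein f) (hunb : ∀ M, ∀ R, ∃ r, R < r ∧ M < f r) :
    StrictMonoOn f (Ioi 0) := by
  intro a ha b hb hab
  refine lt_of_le_of_ne (hf.monotoneOn ha hb hab.le) fun heq => ?_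
  obtain ⟨c, hbc, hc⟩ := hunb (f b) b
  have h := hf.concaveOn.slope_anti_adjacent ha (lt_trans (mem_Ioi.1 hb) hbc) hab hbc
  rw [heq, sub_self, zero_div, div_le_iff₀ (sub_pos.2 hbc), zero_mul] at h
  linarith

theorem inverse_spec {s : ℝ} (h : ∃ r, 0 < r ∧ f r = s) :
    0 < inverse f s ∧ f (inverse f s) = s := by
  obtain ⟨r, hr, rfl⟩ := h
  exact ⟨Function.invFunOn_mem (s := Ioi 0) (f := f) ⟨r, hr, rfl⟩,
    Function.invFunOn_eq (s := Ioi 0) (f := f) ⟨r, hr, rfl⟩⟩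

theorem IsBernstein.exists_eq (hf : IsBernstein f) (hunb : ∀ M, ∀ R, ∃ r, R < r ∧ M < f r)
    (hzero : ∀ ε, 0 < ε → ∃ r, 0 < r ∧ f r < ε) {s : ℝ} (hs : 0 < s) : ∃ r, 0 < r ∧ f r = s := by
  obtain ⟨a, ha, has⟩ := hzero s hs
  obtain ⟨b, hab, hbs⟩ := hunb s a
  obtain ⟨r, hr, hrs⟩ := intermediate_value_Icc hab.le
    (hf.continuousOn.mono fun u hu => lt_of_lt_of_le ha hu.1) ⟨has.le, hbs.le⟩
  exact ⟨r, lt_of_lt_of_le ha hr.1, hrs⟩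

theorem inverse_two_pow_mul_le {g : ℝ → ℝ} {K s₀ : ℝ} (hK : 0 ≤ K)
    (hg : ∀ s, 0 < s → s ≤ s₀ → g (2 * s) ≤ K * g s) {s : ℝ} (hs : 0 < s) (k : ℕ)
    (hk : 2 ^ k * s ≤ 2 * s₀) : g (2 ^ k * s) ≤ K ^ k * g s := by
  induction k with
  | zero => simp
  | succ k ih =>
    have h1 : 2 ^ k * s ≤ s₀ := by
      rw [pow_succ] at hk
      linarith
    have hpos : 0 < 2 ^ k * s := by positivity
    calc g (2 ^ (k + 1) * s) = g (2 * (2 ^ k * s)) := by ring_nf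
      _ ≤ K * g (2 ^ k * s) := hg _ hpos h1
      _ ≤ K * (K ^ k * g s) := by
        gcongr
        exact ih (by linarith)
      _ = K ^ (k + 1) * g s := by ring

/-- Exponential decay of `exp (-t f)` relative to the inverse function at `1 / t`, up to a fixed
level of `f`. -/
theorem mul_exp_neg_le {g : ℝ → ℝ} {K s₀ : ℝ} {m : ℕ} (hK : 0 ≤ K) (hKm : K ≤ 2 ^ m)
    (hg : ∀ s, 0 < s → s ≤ s₀ → g (2 * s) ≤ K * g s) (hg0 : ∀ s, 0 < s → 0 < g s)
    (hgm : ∀ a b, 0 < a → a ≤ b → g a ≤ g b) {t u : ℝ} (ht : 0 < t) (hu : u ≤ s₀)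
    (htu : 1 ≤ t * u) :
    g u * Real.exp (-(t * u)) ≤ 2 ^ m * m.factorial * g (1 / t) := by
  -- With `2^k ≤ t u < 2^(k+1)`, climbing from `1/t` to at least `u` takes `k + 1` doublings and
  -- costs `K^(k+1) ≤ 2^m (t u)^m`. The exponential absorbs this power, since `x^m e^(-x) ≤ m!`.
  obtain ⟨k, hk1, hk2⟩ := exists_nat_pow_near htu one_lt_two
  have hu0 : 0 < u := by
    by_contra! h
    have := mul_nonpos_of_nonneg_of_nonpos ht.le h
    linarith
  have ht' : 0 < 1 / t := by positivity
  have hG := hg0 _ ht'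
  have h1 : g u ≤ g (2 ^ (k + 1) * (1 / t)) := by
    refine hgm _ _ hu0 ?_
    rw [mul_one_div, le_div_iff₀ ht]
    linarith
  have h2 : g (2 ^ (k + 1) * (1 / t)) ≤ K ^ (k + 1) * g (1 / t) := by
    refine inverse_two_pow_mul_le hK hg ht' _ ?_
    rw [mul_one_div, div_le_iff₀ ht, pow_succ]
    nlinarith
  have h3 : K ^ (k + 1) ≤ 2 ^ m * (t * u) ^ m := by
    calc K ^ (k + 1) ≤ (2 ^ m) ^ (k + 1) := by gcongr
      _ = 2 ^ m * (2 ^ k) ^ m := by rw [← pow_mul, ← pow_mul, ← pow_add]; ring_nf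
      _ ≤ 2 ^ m * (t * u) ^ m := by gcongr
  have h4 : (t * u) ^ m * Real.exp (-(t * u)) ≤ m.factorial := by
    have := Real.pow_div_factorial_le_exp (t * u) (by linarith) m
    rw [Real.exp_neg, ← div_eq_mul_inv, div_le_iff₀ (Real.exp_pos _)]
    rw [div_le_iff₀ (by positivity)] at this
    linarith
  calc g u * Real.exp (-(t * u)) ≤ 2 ^ m * (t * u) ^ m * g (1 / t) * Real.exp (-(t * u)) := by
        gcongr
        exact h1.trans (h2.trans (by gcongr))
    _ = 2 ^ m * ((t * u) ^ m * Real.exp (-(t * u))) * g (1 / t) := by ring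
    _ ≤ _ := by gcongr

theorem lintegral_Ioc_inv_sqrt {G : ℝ} (hG : 0 < G) :
    ∫⁻ r in Ioc 0 G, ENNReal.ofReal (1 / √r) = ENNReal.ofReal (2 * √G) := by
  have hI : ∀ r ∈ Ioc 0 G, r ^ (-(1 / 2) : ℝ) = 1 / √r := fun r hr => by
    rw [Real.rpow_neg hr.1.le, ← Real.sqrt_eq_rpow, one_div]
  have hint : IntegrableOn (fun r : ℝ => r ^ (-(1 / 2) : ℝ)) (Ioc 0 G) :=
    (intervalIntegrable_iff_integrableOn_Ioc_of_le hG.le).1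
      (intervalIntegral.intervalIntegrable_rpow' (by norm_num))
  have hval := integral_rpow (a := 0) (b := G) (r := -(1 / 2)) (Or.inl (by norm_num))
  rw [intervalIntegral.integral_of_le hG.le, setIntegral_congr_fun measurableSet_Ioc hI] at hval
  rw [← ofReal_integral_eq_lintegral_ofReal (hint.congr_fun hI measurableSet_Ioc)
    (ae_of_all _ fun r => by positivity), hval]
  congr 1
  rw [show (-(1 / 2) + 1 : ℝ) = 1 / 2 by norm_num, ← Real.sqrt_eq_rpow, ← Real.sqrt_eq_rpow,
    Real.sqrt_zero]
  ring

theorem lintegral_Ioi_inv_mul_sqrt {G : ℝ} (hG : 0 < G) :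
    ∫⁻ r in Ioi G, ENNReal.ofReal (1 / (r * √r)) = ENNReal.ofReal (2 / √G) := by
  have hI : ∀ r ∈ Ioi G, r ^ (-(3 / 2) : ℝ) = 1 / (r * √r) := fun r hr => by
    have hr0 : 0 < r := hG.trans hr
    rw [Real.rpow_neg hr0.le, show (3 / 2 : ℝ) = 1 + 1 / 2 by norm_num, Real.rpow_add hr0,
      Real.rpow_one, ← Real.sqrt_eq_rpow, one_div]
  have hint := integrableOn_Ioi_rpow_of_lt (a := -(3 / 2)) (by norm_num) hG
  have hval := integral_Ioi_rpow_of_lt (a := -(3 / 2)) (by norm_num) hG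
  rw [setIntegral_congr_fun measurableSet_Ioi hI] at hval
  rw [← ofReal_integral_eq_lintegral_ofReal (hint.congr_fun hI measurableSet_Ioi)
    ((ae_restrict_iff' measurableSet_Ioi).2 (ae_of_all _ fun r hr => ?_)), hval]
  · congr 1
    rw [show (-(3 / 2) + 1 : ℝ) = -(1 / 2) by norm_num, Real.rpow_neg hG.le, ← Real.sqrt_eq_rpow]
    ring
  · have : 0 < r := hG.trans hr
    positivity

/-- If `exp (-φ)` decays at least like `M G / r` beyond `G`, then its integral against
`dr / √r` is at most of order `√G`. -/
theorem lintegral_inv_sqrt_mul_exp_neg_le {φ : ℝ → ℝ} {G M : ℝ} (hG : 0 < G) (hM : 0 ≤ M)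
    (h0 : ∀ r, 0 < r → 0 ≤ φ r) (h : ∀ r, G < r → r * Real.exp (-φ r) ≤ M * G) :
    ∫⁻ r in Ioi (0 : ℝ), ENNReal.ofReal (1 / √r * Real.exp (-φ r)) ≤
      ENNReal.ofReal ((2 + 2 * M) * √G) := by
  rw [← Ioc_union_Ioi_eq_Ioi hG.le]
  refine (lintegral_union_le _ _ _).trans ?_
  have hsq : 0 < √G := Real.sqrt_pos.2 hG
  have h1 : ∫⁻ r in Ioc 0 G, ENNReal.ofReal (1 / √r * Real.exp (-φ r)) ≤
      ENNReal.ofReal (2 * √G) := by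
    rw [← lintegral_Ioc_inv_sqrt hG]
    refine setLIntegral_mono' measurableSet_Ioc fun r hr => ENNReal.ofReal_le_ofReal ?_
    refine mul_le_of_le_one_right (by positivity) (Real.exp_le_one_iff.2 ?_)
    linarith [h0 r hr.1]
  have h2 : ∫⁻ r in Ioi G, ENNReal.ofReal (1 / √r * Real.exp (-φ r)) ≤
      ENNReal.ofReal (2 * M * √G) := by
    have heq : ENNReal.ofReal (2 * M * √G) =
        ENNReal.ofReal (M * G) * ENNReal.ofReal (2 / √G) := by
      rw [← ENNReal.ofReal_mul (by positivity)]
      congr 1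
      have := Real.sq_sqrt hG.le
      field_simp
      rw [this]
    rw [heq, ← lintegral_Ioi_inv_mul_sqrt hG, ← lintegral_const_mul' _ _ ENNReal.ofReal_ne_top]
    refine setLIntegral_mono' measurableSet_Ioi fun r hr => ?_
    have hr0 : 0 < r := hG.trans hr
    rw [← ENNReal.ofReal_mul (by positivity)]
    refine ENNReal.ofReal_le_ofReal ?_
    have hsr : 0 < √r := Real.sqrt_pos.2 hr0
    rw [one_div_mul_eq_div, mul_one_div, div_le_div_iff₀ hsr (by positivity)]
    have := mul_le_mul_of_nonneg_right (h r hr) hsr.le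
    linarith
  refine (add_le_add h1 h2).trans (le_of_eq ?_)
  rw [← ENNReal.ofReal_add (by positivity) (by positivity)]
  congr 1
  ring

/-- The task is `r e^(-t f(r)) ≤ M' g(1/t)` for `r > g(1/t)`. Up to `r₁ = g(s₀)` doubling supplies
it; beyond `r₁`, where doubling is not assumed, it is bought with the decay at level `s₀` and
logarithmic growth. -/
theorem IsBernstein.exists_lintegral_le_of_doubling (hf : IsBernstein f) {c R K s₀ : ℝ} (hc : 0 < c)
    (hlog : ∀ r, R ≤ r → c * Real.log r ≤ f r) (hzero : ∀ ε, 0 < ε → ∃ r, 0 < r ∧ f r < ε)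
    (hs₀ : 0 < s₀)
    (hK : ∀ s, 0 < s → s ≤ s₀ → inverse f (2 * s) / inverse f s ≤ K) :
    ∃ C : ℝ, 0 < C ∧ ∃ t₀ : ℝ≥0, 0 < t₀ ∧ ∀ t : ℝ≥0, t₀ ≤ t →
      ∫⁻ r in Ioi (0 : ℝ), ENNReal.ofReal (1 / √r * Real.exp (-((t : ℝ) * f r))) ≤
        ENNReal.ofReal (C * √(inverse f (1 / (t : ℝ)))) := by
  have hunb : ∀ M, ∀ R', ∃ r, R' < r ∧ M < f r := by
    intro M R'
    have h1 := (Real.tendsto_log_atTop.const_mul_atTop hc).eventually_gt_atTop M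
    obtain ⟨r, hr1, hr2, hr3⟩ :=
        (h1.and ((eventually_gt_atTop R').and (eventually_ge_atTop R))).exists
    exact ⟨r, hr2, hr1.trans_le (hlog r hr3)⟩
  have hmono := hf.strictMonoOn hunb
  set g := inverse f with hg
  have hspec : ∀ s, 0 < s → 0 < g s ∧ f (g s) = s := fun s hs =>
    inverse_spec (hf.exists_eq hunb hzero hs)
  have hg0 : ∀ s, 0 < s → 0 < g s := fun s hs => (hspec s hs).1
  have hgm : ∀ a b, 0 < a → a ≤ b → g a ≤ g b := by
    intro a b ha hab
    have hb := ha.trans_le hab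
    rw [← hmono.le_iff_le (hg0 a ha) (hg0 b hb), (hspec a ha).2, (hspec b hb).2]
    exact hab
  have hf0 : ∀ r, 0 < r → 0 < f r := by
    intro r hr
    have h1 := hf.nonneg (r / 2) (by positivity)
    have h2 := hmono (show r / 2 ∈ Ioi 0 from mem_Ioi.2 (by positivity)) hr (by linarith)
    linarith
  have hgf : ∀ r, 0 < r → g (f r) = r := fun r hr =>
    hmono.injOn (hg0 _ (hf0 r hr)) hr (hspec _ (hf0 r hr)).2
  have hK' : ∀ s, 0 < s → s ≤ s₀ → g (2 * s) ≤ K * g s := fun s hs hs' =>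
    (div_le_iff₀ (hg0 s hs)).1 (hK s hs hs')
  have hK0 : 0 ≤ K :=
    (div_pos (hg0 _ (by positivity)) (hg0 _ hs₀)).le.trans (hK s₀ hs₀ le_rfl)
  obtain ⟨m, hm⟩ := pow_unbounded_of_one_lt K one_lt_two
  set M : ℝ := 2 ^ m * m.factorial with hM
  have hM0 : 0 < M := by positivity
  have hdecay : ∀ {t u : ℝ}, 0 < t → u ≤ s₀ → 1 ≤ t * u →
      g u * Real.exp (-(t * u)) ≤ M * g (1 / t) := fun ht hu htu =>
    mul_exp_neg_le hK0 hm.le hK' hg0 hgm ht hu htu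
  set r₁ := g s₀ with hr₁
  have hr₁0 : 0 < r₁ := hg0 _ hs₀
  have hfr₁ : f r₁ = s₀ := (hspec _ hs₀).2
  set R' := max 1 R with hR'
  have hR'1 : 1 ≤ R' := le_max_left _ _
  -- For `r ≥ R` logarithmic growth bounds the product by one; for `r < R` it is at most `R`.
  have htail : ∀ r, 0 < r → r * Real.exp (-(1 / c * f r)) ≤ R' := by
    intro r hr
    rcases le_or_gt R r with h | h
    · have h1 : Real.log r ≤ 1 / c * f r := by
        rw [one_div_mul_eq_div, le_div_iff₀ hc]
        linarith [hlog r h]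
      have h2 : Real.exp (-(1 / c * f r)) ≤ r⁻¹ := by
        rw [Real.exp_neg]
        gcongr
        exact (Real.log_le_iff_le_exp hr).1 h1
      calc r * Real.exp (-(1 / c * f r)) ≤ r * r⁻¹ := by gcongr
        _ = 1 := mul_inv_cancel₀ hr.ne'
        _ ≤ R' := hR'1
    · have h1 : Real.exp (-(1 / c * f r)) ≤ 1 := by
        rw [Real.exp_le_one_iff, neg_nonpos]
        have := hf0 r hr
        positivity
      calc r * Real.exp (-(1 / c * f r)) ≤ r := mul_le_of_le_one_right hr.le h1
        _ ≤ R' := h.le.trans (le_max_right _ _)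
  set M' : ℝ := max M (Real.exp (1 / c * s₀) * (M / r₁) * R') with hM'
  have hM'0 : 0 < M' := lt_max_of_lt_left hM0
  -- `t ≥ 1/c` leaves the factor `e^(-f(r)/c)` needed in the tail; `t ≥ 1/s₀` allows the decay
  -- estimate at level `s₀`.
  refine ⟨2 + 2 * M', by positivity, Real.toNNReal (max (1 / c) (1 / s₀)), ?_, fun t ht => ?_⟩
  · rw [Real.toNNReal_pos]
    exact lt_max_of_lt_left (by positivity)
  rw [Real.toNNReal_le_iff_le_coe] at ht
  have htc : 1 / c ≤ t := (le_max_left _ _).trans ht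
  have hts : 1 / s₀ ≤ t := (le_max_right _ _).trans ht
  have ht0 : (0 : ℝ) < t := lt_of_lt_of_le (by positivity) htc
  have hts' : 1 ≤ t * s₀ := (div_le_iff₀ hs₀).1 hts
  have hG := hspec (1 / t) (by positivity)
  refine lintegral_inv_sqrt_mul_exp_neg_le hG.1 hM'0.le
    (fun r hr => mul_nonneg ht0.le (hf0 r hr).le) fun r hr => ?_
  have hr0 : 0 < r := hG.1.trans hr
  rcases le_or_gt r r₁ with hle | hgt
  · have h1 : f r ≤ s₀ := hfr₁ ▸ hmono.monotoneOn hr0 hr₁0 hle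
    have h2 : 1 ≤ t * f r := by
      have := hmono.monotoneOn hG.1 hr0 (le_of_lt hr)
      rw [hG.2, div_le_iff₀ ht0] at this
      linarith
    have h3 := hdecay ht0 h1 h2
    rw [hgf r hr0] at h3
    exact h3.trans (mul_le_mul_of_nonneg_right (le_max_left _ _) hG.1.le)
  · have h1 : s₀ ≤ f r := hfr₁ ▸ hmono.monotoneOn hr₁0 hr0 hgt.le
    -- This is `(t - 1/c)(f r - s₀) ≥ 0`.
    have h2 : Real.exp (-(t * f r)) ≤
        Real.exp (1 / c * s₀) * Real.exp (-(t * s₀)) * Real.exp (-(1 / c * f r)) := by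
      rw [← Real.exp_add, ← Real.exp_add]
      gcongr
      nlinarith
    have h3 : Real.exp (-(t * s₀)) ≤ M / r₁ * g (1 / t) := by
      have := hdecay ht0 le_rfl hts'
      rw [div_mul_eq_mul_div, le_div_iff₀ hr₁0]
      linarith
    have hGn := hG.1.le
    calc r * Real.exp (-(t * f r))
        ≤ r * (Real.exp (1 / c * s₀) * Real.exp (-(t * s₀)) * Real.exp (-(1 / c * f r))) := by
          gcongr
      _ = Real.exp (1 / c * s₀) * Real.exp (-(t * s₀)) * (r * Real.exp (-(1 / c * f r))) := by ring
      _ ≤ Real.exp (1 / c * s₀) * (M / r₁ * g (1 / t)) * R' := by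
          gcongr
          exact htail r hr0
      _ = Real.exp (1 / c * s₀) * (M / r₁) * R' * g (1 / t) := by ring
      _ ≤ M' * g (1 / t) := by
          gcongr
          exact le_max_right _ _

theorem IsBernstein.exists_lintegral_le (hf : IsBernstein f)
    (h1 : 0 < liminf (fun r : ℝ => ((f r / Real.log r : ℝ) : EReal)) atTop)
    (h2 : liminf (fun r : ℝ => ((f r * |Real.log r| : ℝ) : EReal)) (𝓝[>] 0) < ⊤)
    (h3 : limsup (fun s : ℝ => ((inverse f (2 * s) / inverse f s : ℝ) : EReal)) (𝓝[>] 0) < ⊤) :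
    ∃ C : ℝ, 0 < C ∧ ∃ t₀ : ℝ≥0, 0 < t₀ ∧ ∀ t : ℝ≥0, t₀ ≤ t →
      ∫⁻ r in Ioi (0 : ℝ), ENNReal.ofReal (1 / √r * Real.exp (-((t : ℝ) * f r))) ≤
        ENNReal.ofReal (C * √(inverse f (1 / (t : ℝ)))) := by
  obtain ⟨c, hc, hc'⟩ := EReal.lt_iff_exists_real_btwn.1 h1
  obtain ⟨R, hR⟩ := eventually_atTop.1
    ((eventually_lt_of_lt_liminf hc').and (eventually_gt_atTop (1 : ℝ)))
  obtain ⟨A, hA, -⟩ := EReal.lt_iff_exists_real_btwn.1 h2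
  have hfreq := frequently_lt_of_liminf_lt (by isBoundedDefault) hA
  obtain ⟨K, hK, -⟩ := EReal.lt_iff_exists_real_btwn.1 h3
  have hev := eventually_lt_of_limsup_lt hK
  obtain ⟨s₁, hs₁, hsub⟩ := mem_nhdsGT_iff_exists_Ioo_subset.1 hev
  have hs₁0 : 0 < s₁ := hs₁
  refine hf.exists_lintegral_le_of_doubling (c := c) (R := R) (K := K) (s₀ := s₁ / 2)
    (by exact_mod_cast hc) (fun r hr => ?_) (fun ε hε => ?_) (by positivity) fun s hs hs' => ?_
  · obtain ⟨h, hr1⟩ := hR r hr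
    exact ((lt_div_iff₀ (Real.log_pos hr1)).1 (by exact_mod_cast h)).le
  · have hlog : ∀ᶠ r in 𝓝[>] (0 : ℝ), Real.log r < -(A / ε) :=
      Real.tendsto_log_nhdsGT_zero.eventually_lt_atBot _
    obtain ⟨r, hr1, hr2, hr3⟩ := (hfreq.and_eventually (hlog.and self_mem_nhdsWithin)).exists
    have hr1' : f r * |Real.log r| < A := by exact_mod_cast hr1
    have h4 : A / ε < |Real.log r| := by
      have := neg_abs_le (Real.log r)
      linarith
    rw [div_lt_iff₀ hε] at h4
    refine ⟨r, hr3, ?_⟩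
    by_contra! hle
    have := mul_le_mul_of_nonneg_right hle (abs_nonneg (Real.log r))
    linarith
  · have h := hsub (show s ∈ Ioo 0 s₁ from ⟨hs, by linarith⟩)
    have h' : inverse f (2 * s) / inverse f s < K := by exact_mod_cast h
    exact h'.le

end Bernstein

end SubordinateBM

end

/-! ### The theorem. -/

open SubordinateBM in
theorem theorem2p1 {d : ℕ} {Ω : Type u} [MeasurableSpace Ω] (P : Measure Ω)
    [IsProbabilityMeasure P] (f : ℝ → ℝ) (hf : IsBernstein f) (hf0 : ∃ r, 0 < r ∧ f r ≠ 0)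
    (B : ℝ≥0 → Ω → Eucl d) (S : ℝ≥0 → Ω → ℝ≥0) (hX : IsSubordination P B S f) :
    HasCouplingProperty.{u} (transitionFunction P (subordinate B S)) ∧
    (∀ (t : ℝ≥0), 0 < t → ∀ (x y : Eucl d)
      (Ω' : Type v) (_ : MeasurableSpace Ω') (P' : Measure Ω') (_ : IsProbabilityMeasure P')
      (B' : ℝ≥0 → Ω' → Eucl d) (S' : ℝ≥0 → Ω' → ℝ≥0),
      IsSubordination P' B' S' f → (∀ᵐ ω ∂P', B' 0 ω = x) →
      varNorm (transitionFunction P (subordinate B S) t x)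
          (transitionFunction P (subordinate B S) t y) ≤
        2 * P' {ω | (t : ℝ≥0∞) < reflectionCouplingTime x y B' S' ω} ∧
      2 * P' {ω | (t : ℝ≥0∞) < reflectionCouplingTime x y B' S' ω} ≤
        ENNReal.ofReal (‖x - y‖ / Real.pi) *
          ∫⁻ r in Ioi (0 : ℝ), ENNReal.ofReal (1 / √r * Real.exp (-((t : ℝ) * f r)))) ∧
    (0 < liminf (fun r : ℝ => ((f r / Real.log r : ℝ) : EReal)) atTop →
      liminf (fun r : ℝ => ((f r * |Real.log r| : ℝ) : EReal)) (𝓝[>] 0) < ⊤ →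
      limsup (fun s : ℝ => ((inverse f (2 * s) / inverse f s : ℝ) : EReal)) (𝓝[>] 0) < ⊤ →
      ∃ C : ℝ, 0 < C ∧ ∃ t₀ : ℝ≥0, 0 < t₀ ∧ ∀ t : ℝ≥0, t₀ ≤ t → ∀ x y : Eucl d,
        varNorm (transitionFunction P (subordinate B S) t x)
            (transitionFunction P (subordinate B S) t y) ≤
          ENNReal.ofReal (C * ‖x - y‖ * √(inverse f (1 / (t : ℝ))))) := by
  obtain ⟨lam, hlam, hne⟩ := hf0
  refine ⟨hX.hasCouplingProperty hlam ((hf.nonneg lam hlam).lt_of_ne' hne),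
    fun t _ x y Ω' _ P' _ B' S' hX' hx => varNorm_le_reflectionCoupling hX hX' hx y t,
    fun h1 h2 h3 => ?_⟩
  obtain ⟨C, hC, t₀, ht₀, hle⟩ := hf.exists_lintegral_le h1 h2 h3
  refine ⟨C / Real.pi, by positivity, t₀, ht₀, fun t ht x y => ?_⟩
  -- The estimate in (ii) needs a realization started at `x`; translating the given Brownian motion
  -- provides one.
  obtain ⟨B', S', hX', hx⟩ := hX.exists_startAt x
  have h := varNorm_le_reflectionCoupling hX hX' (ae_of_all _ hx) y t
  calc varNorm (transitionFunction P (subordinate B S) t x)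
        (transitionFunction P (subordinate B S) t y)
      ≤ ENNReal.ofReal (‖x - y‖ / Real.pi) *
          ∫⁻ r in Ioi (0 : ℝ), ENNReal.ofReal (1 / √r * Real.exp (-((t : ℝ) * f r))) :=
        h.1.trans h.2
    _ ≤ ENNReal.ofReal (‖x - y‖ / Real.pi) *
          ENNReal.ofReal (C * √(inverse f (1 / (t : ℝ)))) := by
        gcongr
        exact hle t ht
    _ = ENNReal.ofReal (C / Real.pi * ‖x - y‖ * √(inverse f (1 / (t : ℝ)))) := by
        rw [← ENNReal.ofReal_mul (by positivity)]
        congr 1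
        ring
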